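/- All Hilbert spaces are finite-dimensional and $\log$ is the logarithm to base $2$. A (quantum) state is a positive semidefinite operator of trace one; a state $\rho_{XB}$ on $\mathcal H_X\otimes\mathcal H_B$ is a cq-state if $\rho_{XB}=\sum_{x\in\mathcal X}P_X(x)\,|x\rangle\langle x|\otimes\rho_B^x$ for a probability distribution $P_X$ on a finite set $\mathcal X$, orthonormal vectors $(|x\rangle)_{x\in\mathcal X}$ in $\mathcal H_X$ and states $\rho_B^x$ on $\mathcal H_B$. Write $H(\rho)=-\mathrm{Tr}(\rho\log\rho)$ for the von Neumann entropy and $H(A|B)_\rho=H(\rho_{AB})-H(\rho_B)$ with $\rho_B=\mathrm{Tr}_A\,\rho_{AB}$. For positive semidefinite $\rho_{AB}$ the conditional min-entropy is $$H_\infty(A|B)_\rho=-\log\min\{\mathrm{Tr}\,\sigma_B : \sigma_B\ge 0,\ \rho_{AB}\le \mathrm{id}_A\otimes\sigma_B\},\qquad -\log 0:=+\infty,$$ and the $\varepsilon$-smooth min-entropy of a state $\rho_{AB}$ is $H^\varepsilon_\infty(A|B)_\rho=\sup_{\hat\rho}H_\infty(A|B)_{\hat\rho}$, the supremum being over all positive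 semidefinite operators $\hat\rho$ on $\mathcal H_A\otimes\mathcal H_B$ with $\mathrm{Tr}\,\hat\rho\le 1$ and $\sqrt{1-F(\rho_{AB},\hat\rho)^2}\le\varepsilon$, where $F(\rho,\sigma)=\|\sqrt\rho\sqrt\sigma\|_1$ and $\|A\|_1=\mathrm{Tr}\sqrt{A^\dagger A}$. Let $\rho_{X_1B_1},\dots,\rho_{X_nB_n}$ be (not necessarily equal) cq-states on copies of the same space $\mathcal H_X\otimes\mathcal H_B$. Then for every $\varepsilon>0$ and $n\ge\frac85\log\frac{2}{\varepsilon^2}$, $$H^{\varepsilon}_\infty(X^n|B^n)_{\bigotimes_{i=1}^n\rho_{X_iB_i}}\ \ge\ \sum_{i=1}^n H(X|B)_{\rho_{X_iB_i}}-\delta n,\qquad \delta=\sqrt{\frac{\log(2/\varepsilon^2)}{n}}\cdot 4\log\bigl(2\sqrt{\dim\mathcal H_X}+1\bigr).$$ (If $n=0$, or if $\varepsilon>\sqrt2$ so that the radicand is negative, $\delta$ is read as $0$; these are trivial cases, since the left-hand side is $+\infty$ whenever $\varepsilon\ge1$.) -/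

import Mathlib

open scoped Kronecker ComplexOrder

noncomputable section

/-! Finite-dimensional Hilbert spaces are the coordinate spaces `ℂ^α` for finite index types `α`;
operators are complex matrices; `ℂ^α ⊗ ℂ^β` is `ℂ^(α × β)`. All logarithms are to base two. -/

/-- A quantum state: a positive semidefinite operator of trace one. -/
def IsState {α : Type*} [Fintype α] (ρ : Matrix α α ℂ) : Prop :=
  ρ.PosSemidef ∧ ρ.trace = 1

/-- `ρ` is a cq-state on `ℂ^α ⊗ ℂ^β`, that is `ρ = ∑ x, P x |e x⟩⟨e x| ⊗ σ x` for a probability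
distribution `P` on a finite alphabet, orthonormal vectors `e x` and states `σ x`. -/
def IsCQState {α β : Type*} [Fintype α] [Fintype β]
    (ρ : Matrix (α × β) (α × β) ℂ) : Prop :=
  ∃ (k : ℕ) (P : Fin k → ℝ) (e : Fin k → EuclideanSpace ℂ α) (σ : Fin k → Matrix β β ℂ),
    (∀ x, 0 ≤ P x) ∧ ∑ x, P x = 1 ∧ Orthonormal ℂ e ∧ (∀ x, IsState (σ x)) ∧
    ρ = ∑ x, (P x : ℂ) •
      (Matrix.vecMulVec (e x).ofLp (star (e x).ofLp) ⊗ₖ σ x)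

/-- The partial trace over the first tensor factor. -/
def partialTraceLeft {α β : Type*} [Fintype α]
    (ρ : Matrix (α × β) (α × β) ℂ) : Matrix β β ℂ :=
  fun b b' => ∑ a, ρ (a, b) (a, b')

/-- The von Neumann entropy `-Tr (ρ log ρ)`, with the convention `0 log 0 = 0`. -/
def vonNeumannEntropy {α : Type*} [Fintype α] [DecidableEq α] (ρ : Matrix α α ℂ) : ℝ :=
  -(ρ * cfc (Real.logb 2) ρ).trace.re

/-- The conditional von Neumann entropy `H(A|B) = H(ρ_AB) - H(ρ_B)`. -/
def condEntropy {α β : Type*} [Fintype α] [DecidableEq α] [Fintype β] [DecidableEq β]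
    (ρ : Matrix (α × β) (α × β) ℂ) : ℝ :=
  vonNeumannEntropy ρ - vonNeumannEntropy (partialTraceLeft ρ)

/-- The positive square root of a positive semidefinite operator. -/
def opSqrt {α : Type*} [Fintype α] [DecidableEq α] (A : Matrix α α ℂ) : Matrix α α ℂ :=
  cfc Real.sqrt A

/-- The `L₁`-norm `Tr √(A† A)`. -/
def traceNormOne {α : Type*} [Fintype α] [DecidableEq α] (A : Matrix α α ℂ) : ℝ :=
  (opSqrt (A.conjTranspose * A)).trace.re

/-- The fidelity `F(ρ, σ) = ‖√ρ √σ‖₁`. -/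
def fidelity {α : Type*} [Fintype α] [DecidableEq α] (ρ σ : Matrix α α ℂ) : ℝ :=
  traceNormOne (opSqrt ρ * opSqrt σ)

/-- The distance `C(ρ, σ) = √(1 - F(ρ, σ)²)`. -/
def fidelityDist {α : Type*} [Fintype α] [DecidableEq α] (ρ σ : Matrix α α ℂ) : ℝ :=
  Real.sqrt (1 - fidelity ρ σ ^ 2)

/-- The least trace of a positive semidefinite `σ` on the second factor with `ρ ≤ id ⊗ σ`. -/
def minDominatingTrace {α β : Type*} [Fintype α] [DecidableEq α] [Fintype β]
    (ρ : Matrix (α × β) (α × β) ℂ) : ℝ :=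
  sInf {t : ℝ | ∃ σ : Matrix β β ℂ, σ.PosSemidef ∧
    ((1 : Matrix α α ℂ) ⊗ₖ σ - ρ).PosSemidef ∧ t = σ.trace.re}

/-- `-log t` for `t ≥ 0`, with `-log 0 = +∞`. -/
def negLogTwo (t : ℝ) : EReal :=
  if t = 0 then ⊤ else ((-Real.logb 2 t : ℝ) : EReal)

/-- The conditional min-entropy of a positive semidefinite `ρ_AB` relative to `B`. -/
def minEntropy {α β : Type*} [Fintype α] [DecidableEq α] [Fintype β]
    (ρ : Matrix (α × β) (α × β) ℂ) : EReal :=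
  negLogTwo (minDominatingTrace ρ)

/-- The set of positive semidefinite operators of trace at most one at distance at most `ε`
from `ρ`. -/
def smoothingBall {α : Type*} [Fintype α] [DecidableEq α] (ε : ℝ)
    (ρ : Matrix α α ℂ) : Set (Matrix α α ℂ) :=
  {τ | τ.PosSemidef ∧ fidelityDist ρ τ ≤ ε ∧ τ.trace.re ≤ 1}

/-- The `ε`-smooth conditional min-entropy. -/
def smoothMinEntropy {α β : Type*} [Fintype α] [DecidableEq α] [Fintype β] [DecidableEq β]
    (ε : ℝ) (ρ : Matrix (α × β) (α × β) ℂ) : EReal :=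
  ⨆ τ ∈ smoothingBall ε ρ, minEntropy τ

/-- The product state `⨂ i, ρ i`, as an operator on the tensor product of all first factors
with the tensor product of all second factors. -/
def tensorProd {α β : Type*} {n : ℕ} (ρ : Fin n → Matrix (α × β) (α × β) ℂ) :
    Matrix ((Fin n → α) × (Fin n → β)) ((Fin n → α) × (Fin n → β)) ℂ :=
  fun p q => ∏ i, ρ i (p.1 i, p.2 i) (q.1 i, q.2 i)

end

/-! Write `σ = id ⊗ ρ_B`. For a cq-state, `ρ ≤ σ`. Let `l`, `m` be the eigenvalues of `ρ`, `σ` and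
`U` the overlap matrix of their eigenbases. Everything is controlled by the Petz-type quantity `Q_s
= Tr ρ^(1+s) σ^(-s) = ∑ l i |U j i|² (l i / m j)^s`.

Smoothing (`exists_dominated_of_spectralMatrix`, `exists_dominated_one_sub_le_fidelity`): for every
`c > 0` there is a `τ ≤ c σ` of trace at most one with fidelity to `ρ` at least `1 - c^(-s) Q_s`. It
is `τ = Y Yᴴ`, where `Y` has entries `m j √(l i) / (l i + m j) · U j i` in the two eigenbases (with
`m` replaced by `c m`). This is a soft, noncommutative version of discarding the pairs with `l i > c
m j`; the domination reduces to a Schur multiplier sending unitaries to contractions.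

Moments (`log_sum_rpow_le`): the weights `l i |U j i|²` form a probability distribution, under which
`x = l i / m j` has `𝔼 x ≤ 1` (from `ρ ≤ σ`) and `𝔼 x⁻¹ ≤ dim X`. A second-order expansion of `x^s`
then gives `ln Q_s ≤ -s ln 2 · H(X|B) + 4 s² ln²(2√(dim X) + 1)`.

`Q_s` is multiplicative on tensor products, so the logarithms add up; it remains to choose `c =
2^(-t)` and `s` of order `√(log(2/ε²)/n)`. -/

/-! ### Spectral calculus in an explicitly given eigenbasis -/

open Matrix in
/-- The operator with eigenvalues `d` in the basis formed by the columns of `V`. -/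
noncomputable def spectralMatrix {ι : Type*} [Fintype ι] [DecidableEq ι] (V : Matrix ι ι ℂ)
    (d : ι → ℝ) : Matrix ι ι ℂ :=
  V * diagonal (fun i => (d i : ℂ)) * Vᴴ

namespace spectralMatrix

open Matrix

variable {ι : Type*} [Fintype ι] [DecidableEq ι] {V : Matrix ι ι ℂ}

theorem mul_spectralMatrix (hV : Vᴴ * V = 1) (d e : ι → ℝ) :
    spectralMatrix V d * spectralMatrix V e = spectralMatrix V (fun i => d i * e i) := by
  have : spectralMatrix V d * spectralMatrix V e =
      V * diagonal (fun i => (d i : ℂ)) * (Vᴴ * V) * diagonal (fun i => (e i : ℂ)) * Vᴴ := by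
    simp only [spectralMatrix, Matrix.mul_assoc]
  rw [this, hV]
  simp [spectralMatrix, Matrix.mul_assoc]

theorem spectralMatrix_one (hV : Vᴴ * V = 1) : spectralMatrix V (fun _ => 1) = 1 := by
  simp [spectralMatrix, mul_eq_one_comm.mp hV]

theorem sub_spectralMatrix (d e : ι → ℝ) :
    spectralMatrix V d - spectralMatrix V e = spectralMatrix V (fun i => d i - e i) := by
  rw [spectralMatrix, spectralMatrix, spectralMatrix, ← Matrix.sub_mul, ← Matrix.mul_sub,
    diagonal_sub]
  simp

theorem smul_spectralMatrix (c : ℝ) (d : ι → ℝ) :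
    (c : ℂ) • spectralMatrix V d = spectralMatrix V (fun i => c * d i) := by
  rw [spectralMatrix, spectralMatrix, ← Matrix.smul_mul, ← Matrix.mul_smul, ← diagonal_smul]
  congr 3
  ext i
  simp

theorem isHermitian (d : ι → ℝ) : (spectralMatrix V d).IsHermitian := by
  have : (diagonal (fun i => (d i : ℂ))).IsHermitian := by
    rw [isHermitian_diagonal_iff]
    intro i
    simp [IsSelfAdjoint]
  exact isHermitian_mul_mul_conjTranspose V this

theorem posSemidef {d : ι → ℝ} (hd : ∀ i, 0 ≤ d i) : (spectralMatrix V d).PosSemidef := by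
  apply PosSemidef.mul_mul_conjTranspose_same
  rw [posSemidef_diagonal_iff]
  intro i
  simpa using hd i

theorem trace (hV : Vᴴ * V = 1) (d : ι → ℝ) :
    (spectralMatrix V d).trace = ((∑ i, d i : ℝ) : ℂ) := by
  rw [spectralMatrix, trace_mul_cycle, hV]
  simp [Matrix.trace]

theorem conj_apply (d : ι → ℝ) (W : Matrix ι ι ℂ) (j : ι) :
    (Wᴴ * spectralMatrix V d * W) j j = ((∑ i, d i * ‖(Wᴴ * V) j i‖ ^ 2 : ℝ) : ℂ) := by
  have h : Wᴴ * spectralMatrix V d * W =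
      (Wᴴ * V) * diagonal (fun i => (d i : ℂ)) * (Wᴴ * V)ᴴ := by
    simp [spectralMatrix, Matrix.mul_assoc]
  rw [h, mul_apply]
  push_cast
  refine Finset.sum_congr rfl fun i _ => ?_
  rw [mul_diagonal, conjTranspose_apply, ← Complex.mul_conj']
  simp only [RCLike.star_def]
  ring

theorem conj_self_apply (hV : Vᴴ * V = 1) (d : ι → ℝ) (j : ι) :
    (Vᴴ * spectralMatrix V d * V) j j = (d j : ℂ) := by
  have h : Vᴴ * spectralMatrix V d * V =
      (Vᴴ * V) * diagonal (fun i => (d i : ℂ)) * (Vᴴ * V) := by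
    simp [spectralMatrix, Matrix.mul_assoc]
  rw [h, hV]
  simp

end spectralMatrix

namespace Matrix

variable {ι : Type*} [Fintype ι] [DecidableEq ι]

theorem IsHermitian.exists_spectralMatrix {A : Matrix ι ι ℂ} (hA : A.IsHermitian) :
    (hA.eigenvectorUnitary : Matrix ι ι ℂ)ᴴ * (hA.eigenvectorUnitary : Matrix ι ι ℂ) = 1 ∧
      A = spectralMatrix hA.eigenvectorUnitary hA.eigenvalues := by
  refine ⟨Unitary.coe_star_mul_self hA.eigenvectorUnitary, ?_⟩
  conv_lhs => rw [hA.spectral_theorem, Unitary.conjStarAlgAut_apply]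
  rfl

/-- Makes the functional calculus independent of the eigenbasis. The change of basis `Wᴴ * V`
intertwines the two diagonal forms, so its entries vanish unless the eigenvalues agree, and it
therefore intertwines the images under `f` too. -/
theorem cfc_spectralMatrix {V : Matrix ι ι ℂ} (hV : Vᴴ * V = 1) (d : ι → ℝ) (f : ℝ → ℝ) :
    cfc f (spectralMatrix V d) = spectralMatrix V (fun i => f (d i)) := by
  have hA := spectralMatrix.isHermitian (V := V) d
  rw [hA.cfc_eq, IsHermitian.cfc, Unitary.conjStarAlgAut_apply]
  obtain ⟨hW, hWA⟩ := hA.exists_spectralMatrix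
  set W : Matrix ι ι ℂ := (hA.eigenvectorUnitary : Matrix ι ι ℂ)
  set e := hA.eigenvalues
  have hW' := mul_eq_one_comm.mp hW
  have hV' := mul_eq_one_comm.mp hV
  have h1 : diagonal (fun i => (e i : ℂ)) * (Wᴴ * V) =
      (Wᴴ * V) * diagonal (fun i => (d i : ℂ)) := by
    have h2 : Wᴴ * spectralMatrix V d * V = Wᴴ * spectralMatrix W e * V :=
      congrArg (fun M => Wᴴ * M * V) hWA
    have h3 : Wᴴ * spectralMatrix V d * V =
        (Wᴴ * V) * diagonal (fun i => (d i : ℂ)) * (Vᴴ * V) := by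
      simp only [spectralMatrix, Matrix.mul_assoc]
    have h4 : Wᴴ * spectralMatrix W e * V =
        (Wᴴ * W) * diagonal (fun i => (e i : ℂ)) * (Wᴴ * V) := by
      simp only [spectralMatrix, Matrix.mul_assoc]
    rw [h3, h4, hV, hW, Matrix.mul_one, Matrix.one_mul] at h2
    exact h2.symm
  have h5 : diagonal (fun i => (f (e i) : ℂ)) * (Wᴴ * V) =
      (Wᴴ * V) * diagonal (fun i => (f (d i) : ℂ)) := by
    ext i j
    have := congrFun (congrFun h1 i) j
    rw [diagonal_mul, mul_diagonal] at this ⊢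
    rcases eq_or_ne ((Wᴴ * V) i j) 0 with h0 | h0
    · simp [h0]
    · rw [mul_comm] at this
      have h6 : e i = d j := by exact_mod_cast mul_left_cancel₀ h0 this
      rw [h6, mul_comm]
  change W * diagonal (fun i => (f (e i) : ℂ)) * Wᴴ = _
  calc W * diagonal (fun i => (f (e i) : ℂ)) * Wᴴ
      = W * (diagonal (fun i => (f (e i) : ℂ)) * (Wᴴ * V)) * Vᴴ := by
        rw [← Matrix.mul_assoc, ← Matrix.mul_assoc, Matrix.mul_assoc _ V, hV', Matrix.mul_one]
    _ = (W * Wᴴ) * V * diagonal (fun i => (f (d i) : ℂ)) * Vᴴ := by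
        rw [h5]; simp only [Matrix.mul_assoc]
    _ = _ := by rw [hW', Matrix.one_mul]; rfl

/-! ### Contractions, trace norm and a lower bound for the fidelity -/

/-- Evaluate the trace in an eigenbasis of `Aᴴ * A`: there the columns of `A` have norms equal to
the singular values and the rows of `T` have norm at most one, so Cauchy–Schwarz applies termwise.
-/
theorem re_trace_mul_le_traceNormOne {T : Matrix ι ι ℂ} (hT : (1 - T * Tᴴ).PosSemidef)
    (A : Matrix ι ι ℂ) : (T * A).trace.re ≤ traceNormOne A := by
  have hB : (Aᴴ * A).PosSemidef := posSemidef_conjTranspose_mul_self A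
  obtain ⟨hV, hVA⟩ := hB.1.exists_spectralMatrix
  set V : Matrix ι ι ℂ := (hB.1.eigenvectorUnitary : Matrix ι ι ℂ)
  set d := hB.1.eigenvalues
  have hV' := mul_eq_one_comm.mp hV
  have hnorm : traceNormOne A = ∑ k, √(d k) := by
    rw [traceNormOne, opSqrt, hVA, cfc_spectralMatrix hV, spectralMatrix.trace hV,
      Complex.ofReal_re]
  have htr : (T * A).trace = ∑ k, ∑ l, (Vᴴ * T) k l * (A * V) l k := by
    have : (T * A).trace = ((Vᴴ * T) * (A * V)).trace := by
      rw [trace_mul_comm (Vᴴ * T), Matrix.mul_assoc A, ← Matrix.mul_assoc V, hV', Matrix.one_mul,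
        trace_mul_comm]
    rw [this, Matrix.trace]
    simp only [diag_apply, mul_apply (M := Vᴴ * T)]
  rw [hnorm, htr, Complex.re_sum]
  refine Finset.sum_le_sum fun k _ => ?_
  have h1 : ∑ l, ‖(A * V) l k‖ ^ 2 = d k := by
    have h := spectralMatrix.conj_self_apply hV d k
    rw [← hVA] at h
    have h' : Vᴴ * (Aᴴ * A) * V = (A * V)ᴴ * (A * V) := by simp [Matrix.mul_assoc]
    rw [h', mul_apply] at h
    have h2 : ((∑ l, ‖(A * V) l k‖ ^ 2 : ℝ) : ℂ) = (d k : ℂ) := by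
      rw [← h]
      push_cast
      refine Finset.sum_congr rfl fun l _ => ?_
      rw [conjTranspose_apply, ← Complex.conj_mul']
      rfl
    exact_mod_cast h2
  have h2 : ∑ l, ‖(Vᴴ * T) k l‖ ^ 2 ≤ 1 := by
    have h := (hT.conjTranspose_mul_mul_same V).diag_nonneg (i := k)
    have h' : Vᴴ * (1 - T * Tᴴ) * V = 1 - (Vᴴ * T) * (Vᴴ * T)ᴴ := by
      rw [Matrix.mul_sub, Matrix.sub_mul, Matrix.mul_one, hV]
      simp [Matrix.mul_assoc]
    rw [h', sub_apply, one_apply_eq, mul_apply] at h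
    have h3 : ((1 - ∑ l, ‖(Vᴴ * T) k l‖ ^ 2 : ℝ) : ℂ) =
        1 - ∑ l, (Vᴴ * T) k l * (Vᴴ * T)ᴴ l k := by
      push_cast
      congr 1
      refine Finset.sum_congr rfl fun l _ => ?_
      rw [conjTranspose_apply, ← Complex.mul_conj']
      rfl
    rw [← h3, Complex.zero_le_real] at h
    linarith
  calc (∑ l, (Vᴴ * T) k l * (A * V) l k).re
      ≤ ‖∑ l, (Vᴴ * T) k l * (A * V) l k‖ := Complex.re_le_norm _
    _ ≤ ∑ l, ‖(Vᴴ * T) k l‖ * ‖(A * V) l k‖ := by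
        refine (norm_sum_le _ _).trans_eq ?_
        simp
    _ ≤ √(∑ l, ‖(Vᴴ * T) k l‖ ^ 2) * √(∑ l, ‖(A * V) l k‖ ^ 2) :=
        Real.sum_mul_le_sqrt_mul_sqrt _ _ _
    _ ≤ 1 * √(d k) := by
        rw [h1]
        gcongr
        exact Real.sqrt_le_one.mpr h2
    _ = √(d k) := one_mul _

/-- Polar decomposition with a partial isometry: `T` is the pseudo-inverse of `√(Y Yᴴ)` times `Y`,
the convention `0⁻¹ = 0` handling the kernel. -/
theorem exists_contraction_eq_opSqrt_mul (Y : Matrix ι ι ℂ) :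
    ∃ T : Matrix ι ι ℂ, (1 - T * Tᴴ).PosSemidef ∧ Y = opSqrt (Y * Yᴴ) * T := by
  have hB : (Y * Yᴴ).PosSemidef := posSemidef_self_mul_conjTranspose Y
  obtain ⟨hV, hVA⟩ := hB.1.exists_spectralMatrix
  set V : Matrix ι ι ℂ := (hB.1.eigenvectorUnitary : Matrix ι ι ℂ)
  have hd : ∀ i, 0 ≤ hB.1.eigenvalues i := hB.eigenvalues_nonneg
  set d := hB.1.eigenvalues
  refine ⟨spectralMatrix V (fun i => (√(d i))⁻¹) * Y, ?_, ?_⟩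
  · rw [conjTranspose_mul, ← Matrix.mul_assoc, Matrix.mul_assoc _ Y, hVA,
      (spectralMatrix.isHermitian _).eq, spectralMatrix.mul_spectralMatrix hV,
      spectralMatrix.mul_spectralMatrix hV, ← spectralMatrix.spectralMatrix_one hV,
      spectralMatrix.sub_spectralMatrix]
    refine spectralMatrix.posSemidef fun i => ?_
    rcases (hd i).eq_or_lt with h | h
    · simp [← h]
    · have : (√(d i))⁻¹ * d i * (√(d i))⁻¹ = 1 := by
        have := Real.sqrt_pos.mpr h
        field_simp
        exact (Real.sq_sqrt h.le).symm
      rw [this, sub_self]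
  · have h0 : (1 - spectralMatrix V (fun i => √(d i) * (√(d i))⁻¹)) * (Y * Yᴴ) = 0 := by
      rw [← spectralMatrix.spectralMatrix_one hV, spectralMatrix.sub_spectralMatrix, hVA,
        spectralMatrix.mul_spectralMatrix hV]
      have : (fun i => (1 - √(d i) * (√(d i))⁻¹) * d i) = fun _ => (0 : ℝ) := by
        ext i
        rcases (hd i).eq_or_lt with h | h
        · simp [← h]
        · rw [mul_inv_cancel₀ (Real.sqrt_pos.mpr h).ne', sub_self, zero_mul]
      rw [this]
      simp [spectralMatrix]
    rw [mul_self_mul_conjTranspose_eq_zero, Matrix.sub_mul, Matrix.one_mul, sub_eq_zero] at h0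
    conv_rhs => rw [hVA]
    rw [opSqrt, cfc_spectralMatrix hV, ← Matrix.mul_assoc, spectralMatrix.mul_spectralMatrix hV]
    exact h0

/-- The easy half of Uhlmann's theorem: any `Y` with `Y Yᴴ = τ` bounds `F(ρ, τ)` from below, so `√τ`
never has to be computed. -/
theorem re_trace_opSqrt_mul_le_fidelity (ρ Y : Matrix ι ι ℂ) :
    (opSqrt ρ * Y).trace.re ≤ fidelity ρ (Y * Yᴴ) := by
  obtain ⟨T, hT, hY⟩ := exists_contraction_eq_opSqrt_mul Y
  have : (opSqrt ρ * Y).trace = (T * (opSqrt ρ * opSqrt (Y * Yᴴ))).trace := by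
    rw [trace_mul_comm T, Matrix.mul_assoc, ← hY]
  rw [this]
  exact re_trace_mul_le_traceNormOne hT _

/-- If `R² W + W R² ≤ 1` for positive semidefinite `W`, then `R W R ≤ 1`. -/
theorem one_sub_conj_posSemidef {R W : Matrix ι ι ℂ} (hR : R.IsHermitian) (hW : W.PosSemidef)
    (h : (1 - (R * R * W + W * (R * R))).PosSemidef) : (1 - R * W * R).PosSemidef := by
  have hN : (R * W * R).PosSemidef := by
    have := hW.mul_mul_conjTranspose_same R
    rwa [hR.eq] at this
  have hle : ∀ i, hN.1.eigenvalues i ≤ 1 := by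
    intro i
    by_contra! hlt
    set ν := hN.1.eigenvalues i
    set v : ι → ℂ := (hN.1.eigenvectorBasis i).ofLp
    have hv : (R * W * R) *ᵥ v = (ν : ℂ) • v := hN.1.mulVec_eigenvectorBasis i
    have hv0 : v ≠ 0 := by
      intro h0
      have := (hN.1.eigenvectorBasis).toBasis.ne_zero i
      apply this
      simp only [OrthonormalBasis.coe_toBasis]
      ext j
      exact congrFun h0 j
    -- `w` is an eigenvector of `W R²` with eigenvalue `ν`, and dually for `R² W`; testing `h` on
    -- `w` gives `2 ν ≤ 1`, against `ν > 1`.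
    set w := W *ᵥ (R *ᵥ v)
    have hRw : R *ᵥ w = (ν : ℂ) • v := by
      rw [← hv]
      simp [w, mulVec_mulVec, Matrix.mul_assoc]
    have hw0 : w ≠ 0 := by
      intro h0
      rw [h0, mulVec_zero] at hRw
      have hν : (ν : ℂ) ≠ 0 := by exact_mod_cast (by linarith : ν ≠ 0)
      exact hv0 ((smul_eq_zero.mp hRw.symm).resolve_left hν)
    have h1 : (W * (R * R)) *ᵥ w = (ν : ℂ) • w := by
      rw [← mulVec_mulVec, ← mulVec_mulVec, hRw, mulVec_smul, mulVec_smul]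
    have h2 : star w ⬝ᵥ ((R * R * W) *ᵥ w) = (ν : ℂ) * (star w ⬝ᵥ w) := by
      have e : (W * (R * R))ᴴ = R * R * W := by
        simp [conjTranspose_mul, hR.eq, hW.1.eq]
      rw [← e, dotProduct_mulVec, ← star_mulVec, h1]
      simp
    have h3 := h.dotProduct_mulVec_nonneg w
    rw [sub_mulVec, add_mulVec, one_mulVec, dotProduct_sub, dotProduct_add, h2, h1,
      dotProduct_smul, smul_eq_mul] at h3
    have h4 : 0 < star w ⬝ᵥ w := dotProduct_star_self_pos_iff.mpr hw0
    have h5 : star w ⬝ᵥ w - ((ν : ℂ) * (star w ⬝ᵥ w) + (ν : ℂ) * (star w ⬝ᵥ w)) =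
        ((1 - 2 * ν : ℝ) : ℂ) * (star w ⬝ᵥ w) := by
      push_cast; ring
    rw [h5] at h3
    have h6 : 0 ≤ (1 - 2 * ν) * (star w ⬝ᵥ w).re := by
      have := (Complex.le_def.mp h3).1
      simpa using this
    have h7 : 0 < (star w ⬝ᵥ w).re := (Complex.lt_def.mp h4).1
    nlinarith
  obtain ⟨hV, hVA⟩ := hN.1.exists_spectralMatrix
  rw [hVA, ← spectralMatrix.spectralMatrix_one hV, spectralMatrix.sub_spectralMatrix]
  exact spectralMatrix.posSemidef fun i => sub_nonneg.mpr (hle i)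

end Matrix

/-! ### The smoothing operator -/

namespace Matrix

variable {ι : Type*} [Fintype ι] [DecidableEq ι]

theorem sum_norm_sq_col {U : Matrix ι ι ℂ} (hU : Uᴴ * U = 1) (i : ι) :
    ∑ j, ‖U j i‖ ^ 2 = 1 := by
  have h := congrFun (congrFun hU i) i
  rw [one_apply_eq, mul_apply] at h
  have h2 : ((∑ j, ‖U j i‖ ^ 2 : ℝ) : ℂ) = ((1 : ℝ) : ℂ) := by
    push_cast
    rw [← h]
    refine Finset.sum_congr rfl fun j _ => ?_
    rw [conjTranspose_apply, ← Complex.conj_mul']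
    rfl
  exact_mod_cast h2

theorem sum_norm_sq_row {U : Matrix ι ι ℂ} (hU : Uᴴ * U = 1) (j : ι) :
    ∑ i, ‖U j i‖ ^ 2 = 1 := by
  have h : Uᴴᴴ * Uᴴ = 1 := by rw [conjTranspose_conjTranspose]; exact mul_eq_one_comm.mp hU
  rw [← sum_norm_sq_col h j]
  simp

theorem conjTranspose_mul_unitary {V W : Matrix ι ι ℂ} (hV : Vᴴ * V = 1) (hW : Wᴴ * W = 1) :
    (Wᴴ * V)ᴴ * (Wᴴ * V) = 1 := by
  rw [conjTranspose_mul, conjTranspose_conjTranspose, Matrix.mul_assoc, ← Matrix.mul_assoc W,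
    mul_eq_one_comm.mp hW, Matrix.one_mul, hV]

/-- The Schur multiplier `√(m j) √(l i) / (l i + m j)` maps unitaries to contractions. -/
theorem schur_posSemidef {U : Matrix ι ι ℂ} (hU : Uᴴ * U = 1) {l m : ι → ℝ}
    (hl : ∀ i, 0 ≤ l i) (hm : ∀ i, 0 ≤ m i) :
    (1 - (of fun j i => ((√(m j) * √(l i) / (l i + m j) : ℝ) : ℂ) * U j i) *
      (of fun j i => ((√(m j) * √(l i) / (l i + m j) : ℝ) : ℂ) * U j i)ᴴ).PosSemidef := by
  set K : Matrix ι ι ℂ := of fun j i => ((√(m j) * √(l i) / (l i + m j) : ℝ) : ℂ) * U j i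
  set R : Matrix ι ι ℂ := diagonal fun j => (√(m j) : ℂ) with hRdef
  -- `Z` solves the Sylvester equation `R² Z + Z Q² = U` on the support of `l`. Columns with `l i =
  -- 0` are dropped, since `l i + m j` may vanish there; they contribute nothing to `K`.
  set Z : Matrix ι ι ℂ := of fun j i => if 0 < l i then U j i / ((l i + m j : ℝ) : ℂ) else 0
  set Q : Matrix ι ι ℂ := diagonal fun i => (√(l i) : ℂ) with hQdef
  have hR : R.IsHermitian := by
    rw [isHermitian_diagonal_iff]; intro i; simp [IsSelfAdjoint]
  have hQ : Q.IsHermitian := by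
    rw [isHermitian_diagonal_iff]; intro i; simp [IsSelfAdjoint]
  have hRR : R * R = diagonal fun j => (m j : ℂ) := by
    rw [hRdef, diagonal_mul_diagonal]
    congr 1; ext j
    exact_mod_cast Real.mul_self_sqrt (hm j)
  have hQQ : Q * Q = diagonal fun j => (l j : ℂ) := by
    rw [hQdef, diagonal_mul_diagonal]
    congr 1; ext j
    exact_mod_cast Real.mul_self_sqrt (hl j)
  have hK : K = R * (Z * Q) := by
    ext j i
    simp only [K, R, Z, Q, of_apply, diagonal_mul, mul_diagonal]
    split_ifs with h
    · push_cast; ring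
    · have : l i = 0 := le_antisymm (not_lt.mp h) (hl i)
      simp [this]
  have hKK : K * Kᴴ = R * ((Z * Q) * (Z * Q)ᴴ) * R := by
    rw [hK, conjTranspose_mul R, hR.eq]
    simp only [Matrix.mul_assoc]
  set p : ι → ℂ := fun i => if 0 < l i then 1 else 0 with hp
  have hS : R * R * Z + Z * (Q * Q) = U * diagonal p := by
    rw [hRR, hQQ]
    ext j i
    simp only [Z, p, add_apply, of_apply, diagonal_mul, mul_diagonal]
    split_ifs with h
    · have : ((l i + m j : ℝ) : ℂ) ≠ 0 := by
        exact_mod_cast (add_pos_of_pos_of_nonneg h (hm j)).ne'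
      field_simp
      push_cast; ring
    · simp
  have h1 : (1 - (U * diagonal p) * (U * diagonal p)ᴴ).PosSemidef := by
    have : 1 - (U * diagonal p) * (U * diagonal p)ᴴ = U * diagonal (fun i => 1 - p i) * Uᴴ := by
      have hpp : diagonal p * (diagonal p)ᴴ = diagonal p := by
        rw [diagonal_conjTranspose, diagonal_mul_diagonal]
        congr 1; ext i
        by_cases h : 0 < l i <;> simp [p, h]
      have e : diagonal (fun i => 1 - p i) = 1 - diagonal p := by
        rw [← diagonal_one, diagonal_sub]
      rw [conjTranspose_mul, Matrix.mul_assoc, ← Matrix.mul_assoc (diagonal p), hpp, e,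
        Matrix.mul_sub, Matrix.sub_mul, Matrix.mul_one, mul_eq_one_comm.mp hU, Matrix.mul_assoc]
    rw [this]
    apply PosSemidef.mul_mul_conjTranspose_same
    rw [posSemidef_diagonal_iff]
    intro i
    by_cases h : 0 < l i <;> simp [p, h]
  rw [hKK]
  apply one_sub_conj_posSemidef hR (posSemidef_self_mul_conjTranspose _)
  -- With `A = R² Z` and `B = Z Q²`, the cross terms are `A Bᴴ + B Aᴴ = (A + B)(A + B)ᴴ - A Aᴴ - B
  -- Bᴴ`, and `A + B` is a contraction.
  have h2 : 1 - (R * R * ((Z * Q) * (Z * Q)ᴴ) + (Z * Q) * (Z * Q)ᴴ * (R * R)) =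
      (1 - (U * diagonal p) * (U * diagonal p)ᴴ) + (R * R * Z) * (R * R * Z)ᴴ +
        (Z * (Q * Q)) * (Z * (Q * Q))ᴴ := by
    rw [← hS]
    simp only [conjTranspose_mul, conjTranspose_add, hR.eq, hQ.eq, Matrix.mul_add,
      Matrix.add_mul, Matrix.mul_assoc]
    abel
  rw [h2]
  exact (h1.add (posSemidef_self_mul_conjTranspose _)).add (posSemidef_self_mul_conjTranspose _)

/-- Take `τ = Y Yᴴ` with `Y = W R K Vᴴ` and `K` the Schur-multiplied unitary. Since `K` is a
contraction, `Y Yᴴ ≤ W R² Wᴴ`; the trace bound uses only `m j / (l i + m j) ≤ 1`; the fidelity bound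
is `Tr √ρ Y`. -/
theorem exists_dominated_of_spectralMatrix {V W : Matrix ι ι ℂ} (hV : Vᴴ * V = 1)
    (hW : Wᴴ * W = 1) {l m : ι → ℝ} (hl : ∀ i, 0 ≤ l i) (hm : ∀ i, 0 ≤ m i)
    (hl1 : ∑ i, l i = 1) :
    ∃ τ : Matrix ι ι ℂ, τ.PosSemidef ∧ (spectralMatrix W m - τ).PosSemidef ∧ τ.trace.re ≤ 1 ∧
      ∑ i, ∑ j, l i * ‖(Wᴴ * V) j i‖ ^ 2 * (m j / (l i + m j)) ≤
        fidelity (spectralMatrix V l) τ := by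
  set U := Wᴴ * V with hUdef
  have hU : Uᴴ * U = 1 := conjTranspose_mul_unitary hV hW
  set K : Matrix ι ι ℂ := of fun j i => ((√(m j) * √(l i) / (l i + m j) : ℝ) : ℂ) * U j i with hKd
  set R : Matrix ι ι ℂ := diagonal fun j => (√(m j) : ℂ) with hRdef
  have hK : (1 - K * Kᴴ).PosSemidef := schur_posSemidef hU hl hm
  have hR : R.IsHermitian := by
    rw [isHermitian_diagonal_iff]; intro i; simp [IsSelfAdjoint]
  have hRR : R * R = diagonal fun j => (m j : ℂ) := by
    rw [hRdef, diagonal_mul_diagonal]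
    congr 1; ext j
    exact_mod_cast Real.mul_self_sqrt (hm j)
  have hRK : ∀ j i, (R * K) j i = ((m j * √(l i) / (l i + m j) : ℝ) : ℂ) * U j i := by
    intro j i
    simp only [R, K, diagonal_mul, of_apply]
    rw [← mul_assoc, ← Complex.ofReal_mul, ← mul_div_assoc, ← mul_assoc, Real.mul_self_sqrt (hm j)]
  set Y := W * (R * K) * Vᴴ with hY
  have hYY : Y * Yᴴ = W * ((R * K) * (R * K)ᴴ) * Wᴴ := by
    rw [hY, conjTranspose_mul, conjTranspose_mul W, conjTranspose_conjTranspose]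
    calc W * (R * K) * Vᴴ * (V * ((R * K)ᴴ * Wᴴ))
        = W * (R * K) * (Vᴴ * V) * ((R * K)ᴴ * Wᴴ) := by simp only [Matrix.mul_assoc]
      _ = _ := by rw [hV, Matrix.mul_one]; simp only [Matrix.mul_assoc]
  refine ⟨Y * Yᴴ, posSemidef_self_mul_conjTranspose Y, ?_, ?_, ?_⟩
  · have : spectralMatrix W m - Y * Yᴴ = W * (R * (1 - K * Kᴴ) * Rᴴ) * Wᴴ := by
      rw [hYY, spectralMatrix, ← hRR, hR.eq, Matrix.mul_sub, Matrix.sub_mul, Matrix.mul_one,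
        Matrix.mul_sub, Matrix.sub_mul, conjTranspose_mul, hR.eq]
      simp only [Matrix.mul_assoc]
    rw [this]
    exact (hK.mul_mul_conjTranspose_same R).mul_mul_conjTranspose_same W
  · rw [hYY, trace_mul_cycle, hW, Matrix.one_mul, Matrix.trace, Complex.re_sum]
    have h1 : ∀ j, (((R * K) * (R * K)ᴴ).diag j).re ≤ ∑ i, l i * ‖U j i‖ ^ 2 := by
      intro j
      rw [diag_apply, mul_apply, Complex.re_sum]
      refine Finset.sum_le_sum fun i _ => ?_
      rw [conjTranspose_apply, RCLike.star_def, Complex.mul_conj', ← Complex.ofReal_pow,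
        Complex.ofReal_re, hRK, norm_mul, mul_pow]
      gcongr
      rw [Complex.norm_real, Real.norm_eq_abs, sq_abs, mul_div_right_comm, mul_pow,
        Real.sq_sqrt (hl i)]
      have h2 : m j / (l i + m j) ≤ 1 :=
        div_le_one_of_le₀ (by linarith [hl i]) (add_nonneg (hl i) (hm j))
      have h3 : 0 ≤ m j / (l i + m j) := div_nonneg (hm j) (add_nonneg (hl i) (hm j))
      exact mul_le_of_le_one_left (hl i) (pow_le_one₀ h3 h2)
    refine (Finset.sum_le_sum fun j _ => h1 j).trans ?_
    rw [Finset.sum_comm]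
    simp_rw [← Finset.mul_sum, sum_norm_sq_col hU, mul_one]
    exact hl1.le
  · refine le_trans (le_of_eq ?_) (re_trace_opSqrt_mul_le_fidelity _ Y)
    have h1 : (opSqrt (spectralMatrix V l) * Y).trace =
        (diagonal (fun i => (√(l i) : ℂ)) * (Uᴴ * (R * K))).trace := by
      rw [opSqrt, cfc_spectralMatrix hV, spectralMatrix, hY, hUdef, conjTranspose_mul,
        conjTranspose_conjTranspose, ← Matrix.mul_assoc, trace_mul_comm]
      simp only [← Matrix.mul_assoc]
      rw [hV, Matrix.one_mul]
    rw [h1, Matrix.trace, Complex.re_sum]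
    refine Finset.sum_congr rfl fun i _ => ?_
    rw [diag_apply, diagonal_mul, mul_apply, Finset.mul_sum, Complex.re_sum]
    refine Finset.sum_congr rfl fun j _ => ?_
    rw [conjTranspose_apply, hRK, mul_left_comm (star (U j i)), RCLike.star_def,
      Complex.conj_mul', ← Complex.ofReal_pow, ← Complex.ofReal_mul, ← Complex.ofReal_mul,
      Complex.ofReal_re]
    have := Real.mul_self_sqrt (hl i)
    calc l i * ‖U j i‖ ^ 2 * (m j / (l i + m j))
        = (√(l i) * √(l i)) * ‖U j i‖ ^ 2 * (m j / (l i + m j)) := by rw [this]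
      _ = _ := by ring

end Matrix

/-! Moment estimates for a positive random variable `x` with `𝔼 x ≤ 1` and `𝔼 x⁻¹ ≤ d`. -/

/-- Apply `log y ≤ y - 1` to `y = x^(1/4) / e`. The optimal constant `4 / e` is rounded up so that
its square stays below `11 / 5`. -/
theorem Real.log_le_mul_sqrt_sqrt {x : ℝ} (hx : 0 < x) : Real.log x ≤ (741 / 500) * √√x := by
  have h0 : 0 < √√x := Real.sqrt_pos.mpr (Real.sqrt_pos.mpr hx)
  have h1 : Real.log x = 4 * Real.log (√√x) := by
    rw [Real.log_sqrt (Real.sqrt_nonneg x), Real.log_sqrt hx.le]; ring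
  have h2 : Real.log (√√x / Real.exp 1) ≤ √√x / Real.exp 1 - 1 :=
    Real.log_le_sub_one_of_pos (by positivity)
  rw [Real.log_div h0.ne' (Real.exp_pos 1).ne', Real.log_exp] at h2
  have h3 : √√x / Real.exp 1 ≤ √√x / (27 / 10) := by
    gcongr
    linarith [Real.exp_one_gt_d9]
  rw [h1]
  linarith

theorem Real.log_sq_le_mul_sqrt {x : ℝ} (hx : 1 ≤ x) : Real.log x ^ 2 ≤ 11 / 5 * √x := by
  have h := Real.log_le_mul_sqrt_sqrt (by linarith : 0 < x)
  have h0 : 0 ≤ Real.log x := Real.log_nonneg hx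
  have h1 : √√x ^ 2 = √x := Real.sq_sqrt (Real.sqrt_nonneg x)
  nlinarith [Real.sqrt_nonneg x, Real.sqrt_nonneg (√x)]

theorem Real.log_sq_le_self {x : ℝ} (hx : 1 ≤ x) : Real.log x ^ 2 ≤ x := by
  have h0 : 0 ≤ Real.log x := Real.log_nonneg hx
  set q := √√x
  have hq0 : 0 < q := Real.sqrt_pos.mpr (Real.sqrt_pos.mpr (by linarith))
  have h1 : q ^ 2 = √x := Real.sq_sqrt (Real.sqrt_nonneg x)
  have h2 : √x ^ 2 = x := Real.sq_sqrt (by linarith)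
  have h3 : Real.log x = 4 * Real.log q := by
    rw [Real.log_sqrt (Real.sqrt_nonneg x), Real.log_sqrt (by linarith)]; ring
  have h4 : Real.log q ≤ q - 1 := Real.log_le_sub_one_of_pos hq0
  -- `4 (q - 1) ≤ q²` is `(q - 2)² ≥ 0`.
  have h5 : Real.log x ≤ √x := by nlinarith [sq_nonneg (q - 2)]
  calc Real.log x ^ 2 ≤ √x ^ 2 := by gcongr
    _ = x := h2

/-- Splitting `y = d · (y / d)` makes the dependence on `d` logarithmic: `y / d` has mean at most
one when `y` has mean at most `d`. -/
theorem Real.log_sq_le_add_div {d y : ℝ} (hd : 1 ≤ d) (hy : 1 ≤ y) :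
    Real.log y ^ 2 ≤ 2 * Real.log d ^ 2 + 2 * (y / d) := by
  have hd0 : 0 < d := by linarith
  rcases le_total y d with h | h
  · have h1 : Real.log y ≤ Real.log d := Real.log_le_log (by linarith) h
    have h2 := Real.log_nonneg hy
    have h3 : 0 ≤ y / d := by positivity
    nlinarith
  · have h1 : Real.log y = Real.log d + Real.log (y / d) := by
      rw [Real.log_div (by linarith) hd0.ne']; ring
    have h2 := Real.log_sq_le_self ((one_le_div hd0).mpr h)
    rw [h1]
    nlinarith [sq_nonneg (Real.log d - Real.log (y / d))]

/-- Second-order remainder of `x^s = exp (s log x)`. For `x ≥ 1` it is absorbed by `x`, for `x ≤ 1`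
by `x⁻¹ / d`, the two quantities whose means are under control. -/
theorem Real.rpow_sub_one_sub_le {s x d : ℝ} (hs0 : 0 < s) (hs : s ≤ 1 / 2) (hx : 0 < x)
    (hd : 1 ≤ d) :
    x ^ s - 1 - s * Real.log x ≤
      s ^ 2 * (11 / 5 * x + Real.log d ^ 2 + x⁻¹ / d) := by
  have hd0 : 0 < d := by linarith
  have hxs : x ^ s = Real.exp (s * Real.log x) := by
    rw [Real.rpow_def_of_pos hx, mul_comm]
  rcases le_total 1 x with h | h
  · set u := s * Real.log x with hu
    have hu0 : 0 ≤ u := mul_nonneg hs0.le (Real.log_nonneg h)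
    have h1 : Real.exp u - 1 - u ≤ u ^ 2 * Real.exp u := by
      have h2 := Real.add_one_le_exp (-u)
      have h3 : Real.exp (-u) * Real.exp u = 1 := by rw [← Real.exp_add]; simp
      have h4 : Real.exp u - 1 ≤ u * Real.exp u := by nlinarith [Real.exp_pos u]
      nlinarith
    have h5 : u ^ 2 * Real.exp u ≤ s ^ 2 * (11 / 5 * x) := by
      -- Here `s ≤ 1/2` matters: `x^s` costs at most `√x`, leaving another `√x` to absorb `log² x`.
      have h6 : Real.exp u ≤ √x := by
        rw [← hxs, Real.sqrt_eq_rpow]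
        exact Real.rpow_le_rpow_of_exponent_le h hs
      have h7 := Real.log_sq_le_mul_sqrt h
      calc u ^ 2 * Real.exp u ≤ (s ^ 2 * (11 / 5 * √x)) * √x := by
            rw [hu, mul_pow]; gcongr
        _ = s ^ 2 * (11 / 5 * (√x * √x)) := by ring
        _ = _ := by rw [Real.mul_self_sqrt hx.le]
    rw [hxs]
    have h8 : 0 ≤ s ^ 2 * (Real.log d ^ 2 + x⁻¹ / d) := by positivity
    nlinarith
  · set v := s * Real.log x⁻¹ with hv
    have hy : 1 ≤ x⁻¹ := (one_le_inv₀ hx).mpr h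
    have hv0 : 0 ≤ v := mul_nonneg hs0.le (Real.log_nonneg hy)
    have hu : s * Real.log x = -v := by rw [hv, Real.log_inv]; ring
    have h1 : Real.exp (-v) ≤ 1 - v + v ^ 2 / 2 := by
      have h2 := Real.quadratic_le_exp_of_nonneg hv0
      have h3 : Real.exp (-v) * Real.exp v = 1 := by rw [← Real.exp_add]; simp
      have h4 : Real.exp (-v) * (1 + v + v ^ 2 / 2) ≤ 1 := by
        exact (mul_le_mul_of_nonneg_left h2 (Real.exp_pos _).le).trans_eq h3
      -- The product equals `1 + v⁴ / 4`.
      have h5 : 1 ≤ (1 - v + v ^ 2 / 2) * (1 + v + v ^ 2 / 2) := by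
        nlinarith [sq_nonneg (v ^ 2)]
      have h6 : 0 < 1 + v + v ^ 2 / 2 := by positivity
      exact le_of_mul_le_mul_right (h4.trans h5) h6
    have h7 := Real.log_sq_le_add_div hd hy
    have h8 : v ^ 2 / 2 ≤ s ^ 2 * (Real.log d ^ 2 + x⁻¹ / d) := by
      rw [hv, mul_pow]
      nlinarith [sq_nonneg s]
    rw [hxs, hu]
    have h9 : 0 ≤ s ^ 2 * (11 / 5 * x) := by positivity
    linarith

theorem log_sum_rpow_le {κ : Type*} [Fintype κ] {p x : κ → ℝ} {d s : ℝ} (hp : ∀ k, 0 ≤ p k)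
    (hp1 : ∑ k, p k = 1) (hx : ∀ k, 0 < p k → 0 < x k) (hd : 1 ≤ d)
    (h1 : ∑ k, p k * x k ≤ 1) (h2 : ∑ k, p k * (x k)⁻¹ ≤ d) (hs0 : 0 < s) (hs : s ≤ 1 / 2) :
    0 < ∑ k, p k * x k ^ s ∧ Real.log (∑ k, p k * x k ^ s) ≤
      s * ∑ k, p k * Real.log (x k) + 4 * s ^ 2 * Real.log (2 * √d + 1) ^ 2 := by
  have hpos : 0 < ∑ k, p k * x k ^ s := by
    have hnn : ∀ k ∈ Finset.univ, 0 ≤ p k * x k ^ s := by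
      intro k _
      rcases (hp k).eq_or_lt with h | h
      · simp [← h]
      · exact mul_nonneg h.le (Real.rpow_nonneg (hx k h).le _)
    obtain ⟨k, -, hk⟩ : ∃ k ∈ Finset.univ, 0 < p k := by
      by_contra! hcon
      have : ∑ k, p k ≤ 0 := Finset.sum_nonpos hcon
      linarith
    exact Finset.sum_pos' hnn ⟨k, Finset.mem_univ k, mul_pos hk (Real.rpow_pos_of_pos (hx k hk) _)⟩
  refine ⟨hpos, ?_⟩
  have hd0 : 0 < d := by linarith
  have hterm : ∀ k, p k * x k ^ s ≤ p k + s * (p k * Real.log (x k)) +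
      s ^ 2 * (11 / 5 * (p k * x k) + p k * Real.log d ^ 2 + p k * (x k)⁻¹ / d) := by
    intro k
    rcases (hp k).eq_or_lt with h | h
    · simp [← h]
    · have := mul_le_mul_of_nonneg_left
        (Real.rpow_sub_one_sub_le hs0 hs (hx k h) hd) h.le
      calc p k * x k ^ s = p k * (x k ^ s - 1 - s * Real.log (x k)) + p k +
            s * (p k * Real.log (x k)) := by ring
        _ ≤ p k * (s ^ 2 * (11 / 5 * x k + Real.log d ^ 2 + (x k)⁻¹ / d)) + p k +
            s * (p k * Real.log (x k)) := by gcongr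
        _ = _ := by ring
  have hsum : ∑ k, p k * x k ^ s ≤ 1 + s * ∑ k, p k * Real.log (x k) +
      s ^ 2 * (11 / 5 * ∑ k, p k * x k + Real.log d ^ 2 + (∑ k, p k * (x k)⁻¹) / d) := by
    refine (Finset.sum_le_sum fun k _ => hterm k).trans_eq ?_
    simp only [Finset.sum_add_distrib, ← Finset.mul_sum, ← Finset.sum_mul, ← Finset.sum_div,
      hp1, one_mul]
  have hlog := Real.log_le_sub_one_of_pos hpos
  have h3 : (∑ k, p k * (x k)⁻¹) / d ≤ 1 := (div_le_one hd0).mpr h2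
  -- The origin of `2√d + 1`: `t ≥ log 3 ≥ 1` and `log d ≤ 2 t - 2 log 2`, whence `16/5 + log² d ≤ 4
  -- t²`.
  have h4 : 11 / 5 * ∑ k, p k * x k + Real.log d ^ 2 + (∑ k, p k * (x k)⁻¹) / d ≤
      4 * Real.log (2 * √d + 1) ^ 2 := by
    set t := Real.log (2 * √d + 1)
    have hsd : 1 ≤ √d := Real.one_le_sqrt.mpr hd
    have ht1 : 1 ≤ t := by
      rw [Real.le_log_iff_exp_le (by positivity)]
      linarith [Real.exp_one_lt_d9]
    have ht2 : Real.log 2 + Real.log d / 2 ≤ t := by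
      rw [← Real.log_sqrt hd0.le, ← Real.log_mul (by norm_num) (by positivity)]
      exact Real.log_le_log (by positivity) (by linarith)
    have hld : 0 ≤ Real.log d := Real.log_nonneg hd
    have hl2 := Real.log_two_gt_d9
    have hl3 := Real.log_two_lt_d9
    have h5 : Real.log d ≤ 2 * t - 138 / 100 := by linarith
    have h6 : Real.log d ^ 2 ≤ (2 * t - 138 / 100) ^ 2 := by gcongr
    nlinarith
  nlinarith [sq_nonneg s, mul_le_mul_of_nonneg_left h4 (sq_nonneg s)]

/-! ### Moments of the eigenvalue ratios under operator domination -/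

namespace Matrix

section Dominated

variable {ι : Type*} [Fintype ι] [DecidableEq ι] {V W : Matrix ι ι ℂ} {l m : ι → ℝ}

theorem sum_mul_norm_sq_le_of_dominated (hW : Wᴴ * W = 1)
    (h : (spectralMatrix W m - spectralMatrix V l).PosSemidef) (j : ι) :
    ∑ i, l i * ‖(Wᴴ * V) j i‖ ^ 2 ≤ m j := by
  have h1 := (h.conjTranspose_mul_mul_same W).diag_nonneg (i := j)
  rw [Matrix.mul_sub, Matrix.sub_mul, sub_apply, spectralMatrix.conj_self_apply hW,
    spectralMatrix.conj_apply, ← Complex.ofReal_sub, Complex.zero_le_real] at h1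
  linarith

theorem pos_of_dominated (hW : Wᴴ * W = 1) (hl : ∀ i, 0 ≤ l i)
    (h : (spectralMatrix W m - spectralMatrix V l).PosSemidef) {i j : ι}
    (hij : 0 < l i * ‖(Wᴴ * V) j i‖ ^ 2) : 0 < l i ∧ 0 < m j := by
  refine ⟨pos_of_mul_pos_left hij (sq_nonneg _), hij.trans_le ?_⟩
  refine le_trans ?_ (sum_mul_norm_sq_le_of_dominated hW h j)
  exact Finset.single_le_sum (f := fun i => l i * ‖(Wᴴ * V) j i‖ ^ 2)
    (fun i _ => mul_nonneg (hl i) (sq_nonneg _)) (Finset.mem_univ i)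

/-- If `v` is the `i`-th eigenvector of `ρ`, then `l i |v⟩⟨v| ≤ ρ ≤ σ` forces `l i ⟨v, σ⁻¹ v⟩ ≤ 1`;
the proof tests `σ - ρ` on `σ⁻¹ v`. -/
theorem mul_sum_norm_sq_div_le_one (hW : Wᴴ * W = 1) (hl : ∀ i, 0 ≤ l i) (hm : ∀ j, 0 ≤ m j)
    (h : (spectralMatrix W m - spectralMatrix V l).PosSemidef) (i : ι) :
    l i * ∑ j, ‖(Wᴴ * V) j i‖ ^ 2 / m j ≤ 1 := by
  set U := Wᴴ * V with hU
  set S := ∑ j, ‖U j i‖ ^ 2 / m j with hS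
  have hS0 : 0 ≤ S := Finset.sum_nonneg fun j _ => div_nonneg (sq_nonneg _) (hm j)
  have h1 := h.conjTranspose_mul_mul_same W
  have h2 : Wᴴ * (spectralMatrix W m - spectralMatrix V l) * W =
      diagonal (fun j => (m j : ℂ)) - U * diagonal (fun k => (l k : ℂ)) * Uᴴ := by
    rw [Matrix.mul_sub, Matrix.sub_mul, hU, conjTranspose_mul, conjTranspose_conjTranspose]
    congr 1
    · have : Wᴴ * spectralMatrix W m * W =
          (Wᴴ * W) * diagonal (fun i => (m i : ℂ)) * (Wᴴ * W) := by
        simp [spectralMatrix, Matrix.mul_assoc]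
      rw [this, hW]
      simp
    · simp [spectralMatrix, Matrix.mul_assoc]
  rw [h2] at h1
  -- Coordinates of `σ⁻¹ v` in the eigenbasis of `σ`; division by zero yields the pseudo-inverse.
  set y : ι → ℂ := fun j => U j i / (m j : ℂ) with hy
  have h3 := h1.dotProduct_mulVec_nonneg y
  set z := Uᴴ *ᵥ y with hz
  have h4 : star y ⬝ᵥ (diagonal (fun j => (m j : ℂ)) *ᵥ y) = (S : ℂ) := by
    rw [hS, dotProduct]
    push_cast
    refine Finset.sum_congr rfl fun j _ => ?_
    rw [mulVec_diagonal, Pi.star_apply, RCLike.star_def]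
    simp only [hy, map_div₀, Complex.conj_ofReal]
    rw [← Complex.conj_mul']
    rcases eq_or_ne (m j : ℂ) 0 with h0 | h0
    · simp [h0]
    · field_simp
  have h5 : star y ⬝ᵥ ((U * diagonal (fun k => (l k : ℂ)) * Uᴴ) *ᵥ y) =
      ((∑ k, l k * ‖z k‖ ^ 2 : ℝ) : ℂ) := by
    have h6 : (U * diagonal (fun k => (l k : ℂ)) * Uᴴ) *ᵥ y =
        U *ᵥ (diagonal (fun k => (l k : ℂ)) *ᵥ z) := by
      simp only [hz, mulVec_mulVec, Matrix.mul_assoc]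
    have h7 : star y ᵥ* U = star z := by
      rw [hz, star_mulVec, conjTranspose_conjTranspose]
    rw [h6, dotProduct_mulVec, h7, dotProduct]
    push_cast
    refine Finset.sum_congr rfl fun k _ => ?_
    rw [mulVec_diagonal, Pi.star_apply, RCLike.star_def, ← Complex.conj_mul']
    ring
  have h6 : z i = (S : ℂ) := by
    rw [hz, hS, mulVec, dotProduct]
    push_cast
    refine Finset.sum_congr rfl fun j _ => ?_
    rw [conjTranspose_apply, RCLike.star_def, ← Complex.conj_mul', mul_div_assoc]
  rw [sub_mulVec, dotProduct_sub, h4, h5, ← Complex.ofReal_sub, Complex.zero_le_real] at h3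
  have h7 : l i * ‖z i‖ ^ 2 ≤ ∑ k, l k * ‖z k‖ ^ 2 :=
    Finset.single_le_sum (f := fun k => l k * ‖z k‖ ^ 2)
      (fun k _ => mul_nonneg (hl k) (sq_nonneg _)) (Finset.mem_univ i)
  rw [h6, Complex.norm_real, Real.norm_eq_abs, sq_abs] at h7
  rcases hS0.eq_or_lt with h8 | h8
  · simp [← h8]
  · have h9 : (l i * S) * S ≤ 1 * S := by nlinarith
    exact le_of_mul_le_mul_right h9 h8

/-- The moment bound for the Petz-type quantity `∑ l i |U j i|² (l i / m j) ^ s`. -/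
theorem log_sum_rpow_le_of_dominated (hV : Vᴴ * V = 1) (hW : Wᴴ * W = 1) (hl : ∀ i, 0 ≤ l i)
    (hm : ∀ j, 0 ≤ m j) (h : (spectralMatrix W m - spectralMatrix V l).PosSemidef)
    (hl1 : ∑ i, l i = 1) {d : ℝ} (hd : 1 ≤ d) (hmd : ∑ j, m j ≤ d) {s : ℝ} (hs0 : 0 < s)
    (hs : s ≤ 1 / 2) :
    0 < ∑ i, ∑ j, l i * ‖(Wᴴ * V) j i‖ ^ 2 * (l i / m j) ^ s ∧
    Real.log (∑ i, ∑ j, l i * ‖(Wᴴ * V) j i‖ ^ 2 * (l i / m j) ^ s) ≤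
      s * (∑ i, l i * Real.log (l i) -
        ∑ i, ∑ j, l i * ‖(Wᴴ * V) j i‖ ^ 2 * Real.log (m j)) +
      4 * s ^ 2 * Real.log (2 * √d + 1) ^ 2 := by
  have hU := conjTranspose_mul_unitary hV hW
  have hp0 : ∀ i j, 0 ≤ l i * ‖(Wᴴ * V) j i‖ ^ 2 :=
    fun i j => mul_nonneg (hl i) (sq_nonneg _)
  have hrow : ∀ i, ∑ j, l i * ‖(Wᴴ * V) j i‖ ^ 2 = l i := by
    intro i
    rw [← Finset.mul_sum, sum_norm_sq_col hU, mul_one]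
  have hlog : ∑ i, l i * Real.log (l i) -
        ∑ i, ∑ j, l i * ‖(Wᴴ * V) j i‖ ^ 2 * Real.log (m j) =
      ∑ i, ∑ j, l i * ‖(Wᴴ * V) j i‖ ^ 2 * Real.log (l i / m j) := by
    rw [← Finset.sum_sub_distrib]
    refine Finset.sum_congr rfl fun i _ => ?_
    have : l i * Real.log (l i) = ∑ j, l i * ‖(Wᴴ * V) j i‖ ^ 2 * Real.log (l i) := by
      rw [← Finset.sum_mul, hrow]
    rw [this, ← Finset.sum_sub_distrib]
    refine Finset.sum_congr rfl fun j _ => ?_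
    rcases (hp0 i j).eq_or_lt with h0 | h0
    · simp [← h0]
    · obtain ⟨h1, h2⟩ := pos_of_dominated hW hl h h0
      rw [Real.log_div h1.ne' h2.ne']
      ring
  rw [hlog]
  -- The Nussbaum–Szkoła weights replace two noncommuting operators by one classical distribution on
  -- pairs of eigenvalues.
  have key := log_sum_rpow_le (κ := ι × ι) (p := fun k => l k.1 * ‖(Wᴴ * V) k.2 k.1‖ ^ 2)
    (x := fun k => l k.1 / m k.2) (d := d) (s := s) (fun k => hp0 k.1 k.2)
    (by rw [Fintype.sum_prod_type]; simp only [hrow, hl1])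
    (fun k hk => by
      obtain ⟨h1, h2⟩ := pos_of_dominated hW hl h hk
      exact div_pos h1 h2)
    hd
    (by
      rw [Fintype.sum_prod_type, ← hl1]
      refine Finset.sum_le_sum fun i _ => ?_
      calc ∑ j, l i * ‖(Wᴴ * V) j i‖ ^ 2 * (l i / m j)
          = l i * (l i * ∑ j, ‖(Wᴴ * V) j i‖ ^ 2 / m j) := by
            rw [Finset.mul_sum, Finset.mul_sum]
            refine Finset.sum_congr rfl fun j _ => ?_
            ring
        _ ≤ l i * 1 := by
            gcongr
            · exact hl i
            · exact mul_sum_norm_sq_div_le_one hW hl hm h i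
        _ = l i := mul_one _)
    (by
      rw [Fintype.sum_prod_type]
      refine le_trans ?_ hmd
      rw [Finset.sum_comm]
      refine Finset.sum_le_sum fun j _ => ?_
      -- The factors `l i` cancel; only an inequality holds, because terms with `l i = 0` vanish on
      -- the left.
      calc ∑ i, l i * ‖(Wᴴ * V) j i‖ ^ 2 * (l i / m j)⁻¹
          ≤ ∑ i, m j * ‖(Wᴴ * V) j i‖ ^ 2 := by
            refine Finset.sum_le_sum fun i _ => ?_
            rcases (hl i).eq_or_lt with h0 | h0
            · rw [← h0]
              simpa using mul_nonneg (hm j) (sq_nonneg _)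
            · apply le_of_eq
              rw [inv_div]
              field_simp
        _ = m j := by rw [← Finset.mul_sum, sum_norm_sq_row hU, mul_one])
    hs0 hs
  simpa only [Fintype.sum_prod_type] using key

end Dominated

section Bipartite

theorem trace_one_kronecker_mul {α β : Type*} [Fintype α] [DecidableEq α] [Fintype β]
    (C : Matrix β β ℂ) (ρ : Matrix (α × β) (α × β) ℂ) :
    (((1 : Matrix α α ℂ) ⊗ₖ C) * ρ).trace = (C * partialTraceLeft ρ).trace := by
  simp only [Matrix.trace, diag_apply, mul_apply, kroneckerMap_apply, Fintype.sum_prod_type,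
    partialTraceLeft, one_apply, ite_mul, one_mul, zero_mul, Finset.mul_sum]
  rw [Finset.sum_comm]
  refine Finset.sum_congr rfl fun b _ => ?_
  rw [Finset.sum_comm (s := (Finset.univ : Finset β))]
  refine Finset.sum_congr rfl fun a _ => ?_
  rw [Finset.sum_comm]
  refine Finset.sum_congr rfl fun c _ => ?_
  simp

variable {α β : Type*} [Fintype α] [DecidableEq α] [Fintype β] [DecidableEq β]

theorem kronecker_unitary {W : Matrix β β ℂ} (hW : Wᴴ * W = 1) :
    ((1 : Matrix α α ℂ) ⊗ₖ W)ᴴ * ((1 : Matrix α α ℂ) ⊗ₖ W) = 1 := by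
  rw [conjTranspose_kronecker, ← mul_kronecker_mul, hW]
  simp

theorem spectralMatrix_kronecker (W : Matrix β β ℂ) (d : β → ℝ) :
    spectralMatrix ((1 : Matrix α α ℂ) ⊗ₖ W) (fun p => d p.2) =
      (1 : Matrix α α ℂ) ⊗ₖ spectralMatrix W d := by
  have : (diagonal fun p : α × β => (d p.2 : ℂ)) =
      (1 : Matrix α α ℂ) ⊗ₖ diagonal (fun b => (d b : ℂ)) := by
    rw [← diagonal_one, diagonal_kronecker_diagonal]
    simp
  rw [spectralMatrix, spectralMatrix, this, conjTranspose_kronecker, ← mul_kronecker_mul,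
    ← mul_kronecker_mul]
  simp

theorem trace_partialTraceLeft (ρ : Matrix (α × β) (α × β) ℂ) :
    (partialTraceLeft ρ).trace = ρ.trace := by
  have := trace_one_kronecker_mul (1 : Matrix β β ℂ) ρ
  simpa using this.symm

theorem trace_spectralMatrix_mul {ι : Type*} [Fintype ι] [DecidableEq ι] (V W : Matrix ι ι ℂ)
    (l f : ι → ℝ) :
    (spectralMatrix W f * spectralMatrix V l).trace =
      ((∑ i, ∑ j, l i * ‖(Wᴴ * V) j i‖ ^ 2 * f j : ℝ) : ℂ) := by
  have : (spectralMatrix W f * spectralMatrix V l).trace =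
      (diagonal (fun j => (f j : ℂ)) * (Wᴴ * spectralMatrix V l * W)).trace := by
    rw [spectralMatrix, Matrix.mul_assoc W, Matrix.mul_assoc W, trace_mul_comm]
    simp only [Matrix.mul_assoc]
  rw [this, Finset.sum_comm, Matrix.trace]
  push_cast
  refine Finset.sum_congr rfl fun j _ => ?_
  rw [diag_apply, diagonal_mul, spectralMatrix.conj_apply]
  push_cast
  rw [Finset.mul_sum]
  refine Finset.sum_congr rfl fun i _ => ?_
  ring

theorem vonNeumannEntropy_spectralMatrix {ι : Type*} [Fintype ι] [DecidableEq ι]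
    {V : Matrix ι ι ℂ} (hV : Vᴴ * V = 1) (l : ι → ℝ) :
    vonNeumannEntropy (spectralMatrix V l) = -∑ i, l i * Real.logb 2 (l i) := by
  rw [vonNeumannEntropy, cfc_spectralMatrix hV, spectralMatrix.mul_spectralMatrix hV,
    spectralMatrix.trace hV, Complex.ofReal_re]

end Bipartite

end Matrix

/-! ### Properties of cq-states and their conditional entropy -/

namespace IsCQState

open Matrix

variable {α β : Type*} [Fintype α] [Fintype β] {ρ : Matrix (α × β) (α × β) ℂ}

theorem nonempty_left (hρ : IsCQState ρ) : Nonempty α := by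
  obtain ⟨k, P, e, σ, hP, hP1, he, hσ, rfl⟩ := hρ
  by_contra hα
  rw [not_nonempty_iff] at hα
  have hk : IsEmpty (Fin k) := ⟨fun x => by
    have h1 := he.1 x
    rw [Subsingleton.elim (e x) 0, norm_zero] at h1
    exact zero_ne_one h1⟩
  simp at hP1

theorem posSemidef (hρ : IsCQState ρ) : ρ.PosSemidef := by
  obtain ⟨k, P, e, σ, hP, hP1, he, hσ, rfl⟩ := hρ
  refine posSemidef_sum _ fun x _ => ?_
  refine PosSemidef.smul ?_ (by exact_mod_cast hP x)
  exact (posSemidef_vecMulVec_self_star _).kronecker (hσ x).1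

theorem sum_mul_star {α : Type*} [Fintype α] {e : EuclideanSpace ℂ α} (he : ‖e‖ = 1) :
    ∑ a, e a * star (e a) = 1 := by
  have h1 : ((∑ a, ‖e a‖ ^ 2 : ℝ) : ℂ) = ((1 : ℝ) : ℂ) := by
    rw [EuclideanSpace.norm_eq, Real.sqrt_eq_one] at he
    rw [he]
  push_cast at h1
  rw [← h1]
  refine Finset.sum_congr rfl fun a _ => ?_
  rw [RCLike.star_def, Complex.mul_conj']

theorem trace_eq_one (hρ : IsCQState ρ) : ρ.trace = 1 := by
  obtain ⟨k, P, e, σ, hP, hP1, he, hσ, rfl⟩ := hρ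
  rw [trace_sum]
  have : ∀ x, ((P x : ℂ) • (vecMulVec (e x).ofLp (star (e x).ofLp) ⊗ₖ σ x)).trace = P x := by
    intro x
    rw [trace_smul, trace_kronecker, (hσ x).2, mul_one, trace_vecMulVec, dotProduct]
    have := sum_mul_star (he.1 x)
    simp only [Pi.star_apply, this, smul_eq_mul, mul_one]
  simp only [this]
  exact_mod_cast hP1

variable [DecidableEq α]

/-- This is where the classicality of `X` enters: the difference is a sum of terms `P x (1 - |e x⟩⟨e
x|) ⊗ σ x`, each a projection tensored with a positive operator. It fails for general entangled
states. -/
theorem dominated (hρ : IsCQState ρ) :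
    ((1 : Matrix α α ℂ) ⊗ₖ partialTraceLeft ρ - ρ).PosSemidef := by
  obtain ⟨k, P, e, σ, hP, hP1, he, hσ, rfl⟩ := hρ
  have h1 : partialTraceLeft (∑ x, (P x : ℂ) • (vecMulVec (e x).ofLp (star (e x).ofLp) ⊗ₖ σ x)) =
      ∑ x, (P x : ℂ) • σ x := by
    ext b b'
    simp only [partialTraceLeft, Matrix.sum_apply, Matrix.smul_apply, kroneckerMap_apply,
      vecMulVec_apply, smul_eq_mul, Pi.star_apply]
    rw [Finset.sum_comm]
    refine Finset.sum_congr rfl fun x _ => ?_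
    rw [← Finset.mul_sum, ← Finset.sum_mul, sum_mul_star (he.1 x), one_mul]
  have h2 : (1 : Matrix α α ℂ) ⊗ₖ (∑ x, (P x : ℂ) • σ x) -
      ∑ x, (P x : ℂ) • (vecMulVec (e x).ofLp (star (e x).ofLp) ⊗ₖ σ x) =
      ∑ x, (P x : ℂ) • ((1 - vecMulVec (e x).ofLp (star (e x).ofLp)) ⊗ₖ σ x) := by
    ext p q
    simp only [Matrix.sum_apply, Matrix.smul_apply, kroneckerMap_apply, Matrix.sub_apply, smul_eq_mul,
      Finset.mul_sum, ← Finset.sum_sub_distrib]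
    refine Finset.sum_congr rfl fun x _ => ?_
    ring
  rw [h1, h2]
  refine posSemidef_sum _ fun x _ => ?_
  refine PosSemidef.smul ?_ (by exact_mod_cast hP x)
  refine PosSemidef.kronecker ?_ (hσ x).1
  set E := vecMulVec (e x).ofLp (star (e x).ofLp)
  have hE : E * E = E := by
    simp only [E]
    rw [vecMulVec_mul_vecMulVec]
    have := sum_mul_star (he.1 x)
    have h3 : star (e x).ofLp ⬝ᵥ (e x).ofLp = 1 := by
      rw [dotProduct_comm, dotProduct]; exact this
    simp [h3]
  have hEH : Eᴴ = E := by simp [E, conjTranspose_vecMulVec]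
  have h4 : (1 : Matrix α α ℂ) - E = (1 - E)ᴴ * (1 - E) := by
    have h5 : (1 - E) * (1 - E) = 1 - E - E + E * E := by noncomm_ring
    rw [conjTranspose_sub, conjTranspose_one, hEH, h5, hE]
    abel
  rw [h4]
  exact posSemidef_conjTranspose_mul_self _

theorem posSemidef_partialTraceLeft (hρ : IsCQState ρ) : (partialTraceLeft ρ).PosSemidef := by
  have h : ((1 : Matrix α α ℂ) ⊗ₖ partialTraceLeft ρ).PosSemidef := by
    have := hρ.dominated.add hρ.posSemidef
    rwa [sub_add_cancel] at this
  obtain ⟨a⟩ := hρ.nonempty_left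
  have h2 := h.submatrix (fun b => (a, b))
  have h3 : ((1 : Matrix α α ℂ) ⊗ₖ partialTraceLeft ρ).submatrix
      (fun b => (a, b)) (fun b => (a, b)) = partialTraceLeft ρ := by
    ext b b'
    simp
  rwa [h3] at h2

/-- The eigenbasis of `id ⊗ ρ_B` is taken of the form `1 ⊗ W₀`, so that `Tr ρ log (id ⊗ ρ_B)`
collapses to `Tr ρ_B log ρ_B` and the first-order term becomes the conditional entropy. -/
theorem exists_spectral_data [DecidableEq β] (hρ : IsCQState ρ) :
    ∃ (V W : Matrix (α × β) (α × β) ℂ) (l m : α × β → ℝ), Vᴴ * V = 1 ∧ Wᴴ * W = 1 ∧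
      (∀ i, 0 ≤ l i) ∧ (∀ j, 0 ≤ m j) ∧ ∑ i, l i = 1 ∧ ρ = spectralMatrix V l ∧
      (1 : Matrix α α ℂ) ⊗ₖ partialTraceLeft ρ = spectralMatrix W m ∧
      (∀ i j, 0 < l i * ‖(Wᴴ * V) j i‖ ^ 2 → 0 < l i ∧ 0 < m j) ∧
      ∀ s : ℝ, 0 < s → s ≤ 1 / 2 →
        0 < ∑ i, ∑ j, l i * ‖(Wᴴ * V) j i‖ ^ 2 * (l i / m j) ^ s ∧
        Real.log (∑ i, ∑ j, l i * ‖(Wᴴ * V) j i‖ ^ 2 * (l i / m j) ^ s) ≤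
          -(s * Real.log 2 * condEntropy ρ) +
          4 * s ^ 2 * Real.log (2 * √(Fintype.card α : ℝ) + 1) ^ 2 := by
  obtain ⟨hV, hVρ⟩ := hρ.posSemidef.1.exists_spectralMatrix
  have hB := hρ.posSemidef_partialTraceLeft
  obtain ⟨hW, hWρ⟩ := hB.1.exists_spectralMatrix
  set V : Matrix (α × β) (α × β) ℂ := (hρ.posSemidef.1.eigenvectorUnitary : Matrix (α × β) (α × β) ℂ)
  set W₀ : Matrix β β ℂ := (hB.1.eigenvectorUnitary : Matrix β β ℂ)
  have hl : ∀ i, 0 ≤ hρ.posSemidef.1.eigenvalues i := hρ.posSemidef.eigenvalues_nonneg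
  have hm : ∀ i, 0 ≤ hB.1.eigenvalues i := hB.eigenvalues_nonneg
  set l := hρ.posSemidef.1.eigenvalues
  set m := hB.1.eigenvalues
  have hW' := kronecker_unitary (α := α) hW
  have hσ : (1 : Matrix α α ℂ) ⊗ₖ partialTraceLeft ρ =
      spectralMatrix ((1 : Matrix α α ℂ) ⊗ₖ W₀) (fun p => m p.2) := by
    rw [spectralMatrix_kronecker, ← hWρ]
  have hdom : (spectralMatrix ((1 : Matrix α α ℂ) ⊗ₖ W₀) (fun p => m p.2) -
      spectralMatrix V l).PosSemidef := by
    rw [← hσ, ← hVρ]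
    exact hρ.dominated
  have hl1 : ∑ i, l i = 1 := by
    have h := hρ.trace_eq_one
    rw [hVρ, spectralMatrix.trace hV] at h
    exact_mod_cast h
  have hm1 : ∑ b, m b = 1 := by
    have h := trace_partialTraceLeft ρ
    rw [hρ.trace_eq_one, hWρ, spectralMatrix.trace hW] at h
    exact_mod_cast h
  refine ⟨V, 1 ⊗ₖ W₀, l, fun p => m p.2, hV, hW', hl, fun p => hm p.2, hl1, hVρ, hσ,
    fun i j => pos_of_dominated hW' hl hdom, fun s hs0 hs => ?_⟩
  have hcard : (1 : ℝ) ≤ Fintype.card α := by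
    have := hρ.nonempty_left
    exact_mod_cast Fintype.card_pos (α := α)
  have key := log_sum_rpow_le_of_dominated hV hW' hl (fun p => hm p.2) hdom hl1 hcard
    (by rw [Fintype.sum_prod_type]; simp [hm1]) hs0 hs
  refine ⟨key.1, key.2.trans_eq ?_⟩
  congr 1
  have h1 : ∑ i, ∑ j : α × β, l i * ‖(((1 : Matrix α α ℂ) ⊗ₖ W₀)ᴴ * V) j i‖ ^ 2 * Real.log (m j.2) =
      ∑ b, m b * Real.log (m b) := by
    have h := trace_spectralMatrix_mul V ((1 : Matrix α α ℂ) ⊗ₖ W₀) l (fun p => Real.log (m p.2))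
    rw [spectralMatrix_kronecker W₀ (fun b => Real.log (m b)), ← hVρ, trace_one_kronecker_mul, hWρ,
      spectralMatrix.mul_spectralMatrix hW, spectralMatrix.trace hW] at h
    have h' := Complex.ofReal_injective h
    rw [← h']
    exact Finset.sum_congr rfl fun b _ => mul_comm _ _
  have h2 : Real.log 2 * condEntropy ρ =
      -(∑ i, l i * Real.log (l i) - ∑ b, m b * Real.log (m b)) := by
    have hlog : ∀ x, Real.log 2 * (x * Real.logb 2 x) = x * Real.log x := by
      intro x
      rw [Real.logb]
      have : Real.log 2 ≠ 0 := (Real.log_pos one_lt_two).ne'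
      field_simp
    rw [condEntropy, hWρ, vonNeumannEntropy_spectralMatrix hW]
    conv_lhs => rw [hVρ]
    rw [vonNeumannEntropy_spectralMatrix hV, mul_sub, mul_neg, mul_neg, Finset.mul_sum,
      Finset.mul_sum]
    simp only [hlog]
    ring
  rw [h1, mul_assoc, h2]
  ring

end IsCQState

-- Apply the smoothing construction with `c m` in place of `m`. The loss per pair is `x / (1 + x)`
-- with `x = l i / (c m j)`, and `x / (1 + x) ≤ min x 1 ≤ x^s`, a Markov-type bound.
open Matrix in
theorem exists_dominated_one_sub_le_fidelity {ι : Type*} [Fintype ι] [DecidableEq ι]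
    {V W : Matrix ι ι ℂ} (hV : Vᴴ * V = 1) (hW : Wᴴ * W = 1) {l m : ι → ℝ} (hl : ∀ i, 0 ≤ l i)
    (hm : ∀ i, 0 ≤ m i) (hl1 : ∑ i, l i = 1)
    (hlm : ∀ i j, 0 < l i * ‖(Wᴴ * V) j i‖ ^ 2 → 0 < l i ∧ 0 < m j)
    {c s : ℝ} (hc : 0 < c) (hs0 : 0 ≤ s) (hs1 : s ≤ 1) :
    ∃ τ : Matrix ι ι ℂ, τ.PosSemidef ∧ ((c : ℂ) • spectralMatrix W m - τ).PosSemidef ∧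
      τ.trace.re ≤ 1 ∧
      1 - c ^ (-s) * ∑ i, ∑ j, l i * ‖(Wᴴ * V) j i‖ ^ 2 * (l i / m j) ^ s ≤
        fidelity (spectralMatrix V l) τ := by
  obtain ⟨τ, h1, h2, h3, h4⟩ := exists_dominated_of_spectralMatrix (m := fun j => c * m j) hV hW hl
    (fun j => mul_nonneg hc.le (hm j)) hl1
  refine ⟨τ, h1, by rwa [spectralMatrix.smul_spectralMatrix], h3, le_trans ?_ h4⟩
  have hsum : ∑ i, ∑ j, l i * ‖(Wᴴ * V) j i‖ ^ 2 = 1 := by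
    simp_rw [← Finset.mul_sum, sum_norm_sq_col (conjTranspose_mul_unitary hV hW), mul_one]
    exact hl1
  rw [← hsum, Finset.mul_sum, ← Finset.sum_sub_distrib]
  refine Finset.sum_le_sum fun i _ => ?_
  rw [Finset.mul_sum, ← Finset.sum_sub_distrib]
  refine Finset.sum_le_sum fun j _ => ?_
  have hp : 0 ≤ l i * ‖(Wᴴ * V) j i‖ ^ 2 := mul_nonneg (hl i) (sq_nonneg _)
  set p := l i * ‖(Wᴴ * V) j i‖ ^ 2
  rcases hp.eq_or_lt with h0 | h0
  · simp [← h0]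
  obtain ⟨hli, hmj⟩ := hlm i j h0
  set x := l i / (c * m j) with hx
  have hcm : 0 < c * m j := mul_pos hc hmj
  have hx0 : 0 < x := div_pos hli hcm
  have hxs : c ^ (-s) * (l i / m j) ^ s = x ^ s := by
    have : x = c⁻¹ * (l i / m j) := by rw [hx]; field_simp
    rw [this, Real.mul_rpow (by positivity) (by positivity), Real.inv_rpow hc.le, Real.rpow_neg hc.le]
  have hg : c * m j / (l i + c * m j) = 1 / (1 + x) := by
    rw [hx]; field_simp
    ring
  have hle : 1 - 1 / (1 + x) ≤ x ^ s := by
    have e : 1 - 1 / (1 + x) = x / (1 + x) := by field_simp; ring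
    rw [e]
    rcases le_total x 1 with h | h
    · calc x / (1 + x) ≤ x := div_le_self hx0.le (by linarith)
        _ = x ^ (1 : ℝ) := (Real.rpow_one x).symm
        _ ≤ x ^ s := Real.rpow_le_rpow_of_exponent_ge hx0 h hs1
    · exact (div_le_one_of_le₀ (by linarith) (by linarith)).trans (Real.one_le_rpow h hs0)
  have := mul_le_mul_of_nonneg_left hle hp
  rw [hg, mul_left_comm, hxs]
  linarith

/-! ### Tensor products -/

section TensorProd

open Matrix

variable {α β : Type*} {n : ℕ}

theorem sum_prod_pi [Fintype α] [Fintype β]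
    {R : Type*} [CommSemiring R] [DecidableEq α] [DecidableEq β]
    (f : Fin n → α × β → R) :
    ∑ p : (Fin n → α) × (Fin n → β), ∏ i, f i (p.1 i, p.2 i) = ∏ i, ∑ a, f i a := by
  rw [Finset.prod_univ_sum, Fintype.piFinset_univ]
  symm
  exact Fintype.sum_equiv (Equiv.arrowProdEquivProdArrow (Fin n) (fun _ => α) (fun _ => β)) _ _
    fun _ => rfl

theorem tensorProd_conjTranspose (A : Fin n → Matrix (α × β) (α × β) ℂ) :
    (tensorProd A)ᴴ = tensorProd fun i => (A i)ᴴ := by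
  ext p q
  simp [tensorProd, conjTranspose_apply]

theorem tensorProd_mul [Fintype α] [Fintype β] [DecidableEq α] [DecidableEq β]
    (A C : Fin n → Matrix (α × β) (α × β) ℂ) :
    tensorProd A * tensorProd C = tensorProd fun i => A i * C i := by
  ext p q
  simp only [mul_apply, tensorProd, ← Finset.prod_mul_distrib]
  exact sum_prod_pi fun i a => A i (p.1 i, p.2 i) a * C i a (q.1 i, q.2 i)

theorem tensorProd_diagonal [DecidableEq α] [DecidableEq β]
    (d : Fin n → α × β → ℂ) :
    tensorProd (fun i => diagonal (d i)) = diagonal fun p => ∏ i, d i (p.1 i, p.2 i) := by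
  ext p q
  rw [tensorProd, diagonal_apply]
  split_ifs with h
  · simp [h]
  · obtain ⟨i, hi⟩ : ∃ i, (p.1 i, p.2 i) ≠ (q.1 i, q.2 i) := by
      by_contra! hcon
      refine h (Prod.ext (funext fun i => ?_) (funext fun i => ?_))
      · exact congrArg Prod.fst (hcon i)
      · exact congrArg Prod.snd (hcon i)
    exact Finset.prod_eq_zero (Finset.mem_univ i) (diagonal_apply_ne _ hi)

theorem tensorProd_one [DecidableEq α] [DecidableEq β] :
    tensorProd (fun _ : Fin n => (1 : Matrix (α × β) (α × β) ℂ)) = 1 := by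
  simp only [← diagonal_one, tensorProd_diagonal, Finset.prod_const_one]

theorem tensorProd_unitary [Fintype α] [Fintype β] [DecidableEq α] [DecidableEq β]
    {V : Fin n → Matrix (α × β) (α × β) ℂ} (hV : ∀ i, (V i)ᴴ * V i = 1) :
    (tensorProd V)ᴴ * tensorProd V = 1 := by
  rw [tensorProd_conjTranspose, tensorProd_mul]
  simp only [hV, tensorProd_one]

theorem tensorProd_spectralMatrix [Fintype α] [Fintype β] [DecidableEq α] [DecidableEq β]
    (V : Fin n → Matrix (α × β) (α × β) ℂ)
    (d : Fin n → α × β → ℝ) :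
    tensorProd (fun i => spectralMatrix (V i) (d i)) =
      spectralMatrix (tensorProd V) fun p => ∏ i, d i (p.1 i, p.2 i) := by
  simp only [spectralMatrix, Complex.ofReal_prod]
  rw [← tensorProd_diagonal (fun i a => (d i a : ℂ)), tensorProd_conjTranspose, tensorProd_mul,
    tensorProd_mul]

theorem tensorProd_one_kronecker [DecidableEq α] (σ : Fin n → Matrix β β ℂ) :
    tensorProd (fun i => (1 : Matrix α α ℂ) ⊗ₖ σ i) =
      (1 : Matrix (Fin n → α) (Fin n → α) ℂ) ⊗ₖ
        (of fun b b' => ∏ i, σ i (b i) (b' i)) := by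
  ext p q
  simp only [tensorProd, kroneckerMap_apply, Finset.prod_mul_distrib, of_apply]
  congr 1
  rw [one_apply]
  split_ifs with h
  · refine Finset.prod_eq_one fun i _ => ?_
    change (1 : Matrix α α ℂ) (p.1 i) (q.1 i) = 1
    rw [h, one_apply_eq]
  · obtain ⟨i, hi⟩ := Function.ne_iff.mp h
    exact Finset.prod_eq_zero (Finset.mem_univ i) (one_apply_ne hi)

theorem trace_prod_pi [Fintype β] (σ : Fin n → Matrix β β ℂ) :
    (of fun b b' : Fin n → β => ∏ i, σ i (b i) (b' i)).trace = ∏ i, (σ i).trace := by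
  simp only [Matrix.trace, diag_apply, of_apply]
  rw [Finset.prod_univ_sum, Fintype.piFinset_univ]

/-- Multiplicativity of `Q_s`: in product eigenbases the eigenvalues and the overlaps both
factorise. -/
theorem sum_overlap_tensorProd [Fintype α] [Fintype β] [DecidableEq α] [DecidableEq β]
    {V W : Fin n → Matrix (α × β) (α × β) ℂ}
    {l m : Fin n → α × β → ℝ} (hl : ∀ k i, 0 ≤ l k i) (hm : ∀ k i, 0 ≤ m k i) (s : ℝ) :
    ∑ p : (Fin n → α) × (Fin n → β), ∑ q : (Fin n → α) × (Fin n → β),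
      (∏ k, l k (p.1 k, p.2 k)) * ‖((tensorProd W)ᴴ * tensorProd V) q p‖ ^ 2 *
        ((∏ k, l k (p.1 k, p.2 k)) / ∏ k, m k (q.1 k, q.2 k)) ^ s =
    ∏ k, ∑ i, ∑ j, l k i * ‖((W k)ᴴ * V k) j i‖ ^ 2 * (l k i / m k j) ^ s := by
  rw [← sum_prod_pi fun k i => ∑ j, l k i * ‖((W k)ᴴ * V k) j i‖ ^ 2 * (l k i / m k j) ^ s]
  refine Finset.sum_congr rfl fun p _ => ?_
  rw [← sum_prod_pi fun k j => l k (p.1 k, p.2 k) * ‖((W k)ᴴ * V k) j (p.1 k, p.2 k)‖ ^ 2 *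
    (l k (p.1 k, p.2 k) / m k j) ^ s]
  refine Finset.sum_congr rfl fun q _ => ?_
  rw [tensorProd_conjTranspose, tensorProd_mul, tensorProd, norm_prod, ← Finset.prod_div_distrib,
    ← Real.finsetProd_rpow _ _ fun k _ => div_nonneg (hl k _) (hm k _), ← Finset.prod_pow,
    ← Finset.prod_mul_distrib, ← Finset.prod_mul_distrib]

theorem pos_of_overlap_tensorProd [Fintype α] [Fintype β] [DecidableEq α] [DecidableEq β]
    {V W : Fin n → Matrix (α × β) (α × β) ℂ}
    {l m : Fin n → α × β → ℝ} (hl : ∀ k i, 0 ≤ l k i)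
    (hlm : ∀ k i j, 0 < l k i * ‖((W k)ᴴ * V k) j i‖ ^ 2 → 0 < l k i ∧ 0 < m k j)
    (p q : (Fin n → α) × (Fin n → β))
    (h : 0 < (∏ k, l k (p.1 k, p.2 k)) * ‖((tensorProd W)ᴴ * tensorProd V) q p‖ ^ 2) :
    0 < ∏ k, l k (p.1 k, p.2 k) ∧ 0 < ∏ k, m k (q.1 k, q.2 k) := by
  rw [tensorProd_conjTranspose, tensorProd_mul, tensorProd, norm_prod, ← Finset.prod_pow,
    ← Finset.prod_mul_distrib] at h
  have hk : ∀ k, 0 < l k (p.1 k, p.2 k) ∧ 0 < m k (q.1 k, q.2 k) := fun k =>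
    hlm k _ _ ((mul_nonneg (hl k _) (sq_nonneg _)).lt_of_ne'
      (Finset.prod_ne_zero_iff.mp h.ne' k (Finset.mem_univ k)))
  exact ⟨Finset.prod_pos fun k _ => (hk k).1, Finset.prod_pos fun k _ => (hk k).2⟩

end TensorProd

/-! ### Min-entropy bounds from explicit witnesses -/

section MinEntropy

open Matrix

theorem neg_logb_le_negLogTwo {t c : ℝ} (ht : 0 ≤ t) (htc : t ≤ c) :
    ((-Real.logb 2 c : ℝ) : EReal) ≤ negLogTwo t := by
  rw [negLogTwo]
  split_ifs with h
  · exact le_top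
  · have ht' : 0 < t := ht.lt_of_ne' h
    rw [EReal.coe_le_coe_iff, neg_le_neg_iff]
    exact Real.logb_le_logb_of_le one_lt_two ht' htc

variable {α β : Type*} [Fintype α] [DecidableEq α] [Fintype β]

theorem le_minEntropy {τ : Matrix (α × β) (α × β) ℂ} {σ : Matrix β β ℂ} (hσ : σ.PosSemidef)
    (h : ((1 : Matrix α α ℂ) ⊗ₖ σ - τ).PosSemidef) :
    ((-Real.logb 2 σ.trace.re : ℝ) : EReal) ≤ minEntropy τ := by
  have hnn : ∀ t ∈ {t : ℝ | ∃ σ : Matrix β β ℂ, σ.PosSemidef ∧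
      ((1 : Matrix α α ℂ) ⊗ₖ σ - τ).PosSemidef ∧ t = σ.trace.re}, 0 ≤ t := by
    rintro t ⟨σ', hσ', -, rfl⟩
    exact (Complex.le_def.mp hσ'.trace_nonneg).1
  exact neg_logb_le_negLogTwo (Real.sInf_nonneg hnn) (csInf_le ⟨0, hnn⟩ ⟨σ, hσ, h, rfl⟩)

theorem minEntropy_zero : minEntropy (0 : Matrix (α × β) (α × β) ℂ) = ⊤ := by
  have h : minDominatingTrace (0 : Matrix (α × β) (α × β) ℂ) = 0 := by
    have hnn : ∀ t ∈ {t : ℝ | ∃ σ : Matrix β β ℂ, σ.PosSemidef ∧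
        ((1 : Matrix α α ℂ) ⊗ₖ σ - 0).PosSemidef ∧ t = σ.trace.re}, 0 ≤ t := by
      rintro t ⟨σ', hσ', -, rfl⟩
      exact (Complex.le_def.mp hσ'.trace_nonneg).1
    refine le_antisymm (csInf_le ⟨0, hnn⟩ ⟨0, PosSemidef.zero, ?_, by simp⟩)
      (Real.sInf_nonneg hnn)
    simpa using PosSemidef.zero
  rw [minEntropy, h, negLogTwo, if_pos rfl]

theorem smoothMinEntropy_eq_top [DecidableEq β] {ε : ℝ} (hε : 1 ≤ ε)
    (ρ : Matrix (α × β) (α × β) ℂ) : smoothMinEntropy ε ρ = ⊤ := by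
  rw [eq_top_iff, ← minEntropy_zero (α := α) (β := β)]
  refine le_iSup₂ (f := fun τ _ => minEntropy τ) (0 : Matrix (α × β) (α × β) ℂ) ?_
  refine ⟨PosSemidef.zero, le_trans ?_ hε, by simp⟩
  rw [fidelityDist, Real.sqrt_le_one]
  linarith [sq_nonneg (fidelity ρ 0)]

end MinEntropy

/-! ### Assembly and choice of parameters -/

theorem fidelityDist_le {ι : Type*} [Fintype ι] [DecidableEq ι] {ρ τ : Matrix ι ι ℂ} {ε : ℝ}
    (hε0 : 0 < ε) (hε1 : ε < 1) (h : 1 - ε ^ 2 / 2 ≤ fidelity ρ τ) : fidelityDist ρ τ ≤ ε := by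
  rw [fidelityDist, Real.sqrt_le_left hε0.le]
  have h1 : ε ^ 2 < 1 := by nlinarith
  have h2 : (1 - ε ^ 2 / 2) ^ 2 ≤ fidelity ρ τ ^ 2 := pow_le_pow_left₀ (by linarith) h 2
  nlinarith [sq_nonneg (ε ^ 2)]

open Matrix in
/-- One-shot form: a bound on the moments of order `s` gives a bound on the smooth
min-entropy. -/
theorem le_smoothMinEntropy_tensorProd {X B : Type*} [Fintype X] [DecidableEq X] [Fintype B]
    [DecidableEq B] [Nonempty X] {n : ℕ} {ρ : Fin n → Matrix (X × B) (X × B) ℂ}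
    (hρ : ∀ i, IsCQState (ρ i)) {ε s t : ℝ} (hε0 : 0 < ε) (hε1 : ε < 1) (hs0 : 0 < s)
    (hs : s ≤ 1 / 2)
    (ht : s * t * Real.log 2 + ∑ i, (-(s * Real.log 2 * condEntropy (ρ i)) +
      4 * s ^ 2 * Real.log (2 * √(Fintype.card X : ℝ) + 1) ^ 2) ≤ Real.log (ε ^ 2 / 2)) :
    (t : EReal) ≤ smoothMinEntropy ε (tensorProd ρ) := by
  choose V W l m hV hW hl hm hl1 hVρ hWρ hlm hQ using fun i => (hρ i).exists_spectral_data
  set c : ℝ := 2 ^ (-t) with hc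
  have hc0 : 0 < c := Real.rpow_pos_of_pos two_pos _
  obtain ⟨τ, hτ, hτc, hτ1, hF⟩ := exists_dominated_one_sub_le_fidelity
    (l := fun p : (Fin n → X) × (Fin n → B) => ∏ k, l k (p.1 k, p.2 k))
    (m := fun p : (Fin n → X) × (Fin n → B) => ∏ k, m k (p.1 k, p.2 k)) (s := s)
    (tensorProd_unitary hV) (tensorProd_unitary hW)
    (fun p => Finset.prod_nonneg fun k _ => hl k _) (fun p => Finset.prod_nonneg fun k _ => hm k _)
    (by rw [sum_prod_pi]; simp [hl1]) (pos_of_overlap_tensorProd hl hlm) hc0 hs0.le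
    (by linarith)
  rw [sum_overlap_tensorProd hl hm, ← tensorProd_spectralMatrix] at hF
  rw [← tensorProd_spectralMatrix] at hτc
  simp only [← hVρ] at hF
  simp only [← hWρ] at hτc
  rw [tensorProd_one_kronecker, ← kronecker_smul] at hτc
  set σ : Matrix (Fin n → B) (Fin n → B) ℂ :=
    (c : ℂ) • of fun b b' => ∏ i, partialTraceLeft (ρ i) (b i) (b' i) with hσ
  have hσtr : σ.trace.re = c := by
    have h1 : ∀ i, (partialTraceLeft (ρ i)).trace = 1 := fun i => by
      rw [trace_partialTraceLeft, (hρ i).trace_eq_one]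
    rw [hσ, trace_smul, trace_prod_pi]
    simp [h1]
  -- `id ⊗ σ ≥ τ ≥ 0`, and `σ` is a diagonal block of `id ⊗ σ`.
  have hσpos : σ.PosSemidef := by
    have h1 : ((1 : Matrix (Fin n → X) (Fin n → X) ℂ) ⊗ₖ σ).PosSemidef := by
      have := hτc.add hτ
      rwa [sub_add_cancel] at this
    have h2 := h1.submatrix fun b => ((fun _ => Classical.arbitrary X : Fin n → X), b)
    convert h2 using 1
    ext b b'
    simp
  have hball : τ ∈ smoothingBall ε (tensorProd ρ) := by
    refine ⟨hτ, fidelityDist_le hε0 hε1 (le_trans ?_ hF), hτ1⟩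
    have hprod := Finset.prod_pos fun k (_ : k ∈ Finset.univ) => (hQ k s hs0 hs).1
    rw [sub_le_sub_iff_left, ← Real.log_le_log_iff (mul_pos (Real.rpow_pos_of_pos hc0 _) hprod)
      (by positivity), Real.log_mul (Real.rpow_pos_of_pos hc0 _).ne' hprod.ne',
      Real.log_prod fun k _ => (hQ k s hs0 hs).1.ne']
    refine le_trans (add_le_add (le_of_eq ?_) (Finset.sum_le_sum fun k _ => (hQ k s hs0 hs).2)) ht
    rw [Real.log_rpow hc0, hc, Real.log_rpow two_pos]
    ring
  refine le_trans ?_ (le_iSup₂ (f := fun τ _ => minEntropy τ) τ hball)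
  refine le_trans (le_of_eq ?_) (le_minEntropy hσpos hτc)
  rw [hσtr, hc, Real.logb_rpow two_pos (by norm_num), neg_neg]

theorem corollary1 {X B : Type*} [Fintype X] [DecidableEq X] [Fintype B] [DecidableEq B]
    (n : ℕ) (ρ : Fin n → Matrix (X × B) (X × B) ℂ) (hρ : ∀ i, IsCQState (ρ i))
    (ε : ℝ) (hε : 0 < ε) (hn : 8 / 5 * Real.logb 2 (2 / ε ^ 2) ≤ (n : ℝ))
    (δ : ℝ)
    (hδ : δ = Real.sqrt (Real.logb 2 (2 / ε ^ 2) / n) *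
      (4 * Real.logb 2 (2 * Real.sqrt (Fintype.card X) + 1))) :
    (((∑ i, condEntropy (ρ i)) - δ * n : ℝ) : EReal) ≤ smoothMinEntropy ε (tensorProd ρ) := by
  rcases le_or_gt 1 ε with hε1 | hε1
  · rw [smoothMinEntropy_eq_top hε1]
    exact le_top
  set L := Real.logb 2 (2 / ε ^ 2) with hL
  have hL0 : 0 < L := Real.logb_pos one_lt_two (by
    rw [lt_div_iff₀ (by positivity)]; nlinarith)
  have hn0 : (0 : ℝ) < n := by linarith
  have hX : Nonempty X := (hρ ⟨0, by exact_mod_cast hn0⟩).nonempty_left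
  set g := Real.logb 2 (2 * Real.sqrt (Fintype.card X) + 1) with hg
  have hcard : (1 : ℝ) ≤ √(Fintype.card X : ℝ) :=
    Real.one_le_sqrt.mpr (by exact_mod_cast Fintype.card_pos (α := X))
  have hg1 : 1 ≤ g := by
    rw [hg, Real.le_logb_iff_rpow_le one_lt_two (by positivity), Real.rpow_one]
    linarith
  set r := √(L / n) with hr
  have hr0 : 0 < r := Real.sqrt_pos.mpr (div_pos hL0 hn0)
  have hr2 : r ^ 2 * n = L := by
    rw [hr, Real.sq_sqrt (div_pos hL0 hn0).le, div_mul_cancel₀ _ hn0.ne']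
  have hr1 : r ≤ 1 := by
    rw [hr, Real.sqrt_le_one, div_le_one hn0]
    linarith
  have hln2 : 0 < Real.log 2 := Real.log_pos one_lt_two
  have hln2' : Real.log 2 ≤ 1 := by linarith [Real.log_two_lt_d9]
  have hlg : Real.log (2 * √(Fintype.card X : ℝ) + 1) = g * Real.log 2 := by
    rw [hg, Real.logb, div_mul_cancel₀ _ hln2.ne']
  have hlε : Real.log (ε ^ 2 / 2) = -(L * Real.log 2) := by
    rw [hL, Real.logb, div_mul_cancel₀ _ hln2.ne', ← Real.log_inv, inv_div]
  -- With `s = r / (2 g)` the exponent becomes `-L ln 2 (2 - ln 2)`, which is at most `-L ln 2 = ln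
  -- (ε² / 2)` because `ln 2 ≤ 1`. The bounds `r ≤ 1` and `g ≥ 1` ensure `s ≤ 1/2`.
  refine le_smoothMinEntropy_tensorProd hρ hε hε1 (s := r / (2 * g)) (by positivity) ?_ ?_
  · rw [div_le_div_iff₀ (by positivity) two_pos]
    linarith
  · rw [hlg, hlε, hδ, Finset.sum_add_distrib, Finset.sum_neg_distrib, ← Finset.mul_sum,
      Finset.sum_const, Finset.card_univ, Fintype.card_fin, nsmul_eq_mul]
    have e : r / (2 * g) * (∑ i, condEntropy (ρ i) - r * (4 * g) * n) * Real.log 2 +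
        (-(r / (2 * g) * Real.log 2 * ∑ i, condEntropy (ρ i)) +
          n * (4 * (r / (2 * g)) ^ 2 * (g * Real.log 2) ^ 2)) =
        (r ^ 2 * n) * Real.log 2 * (Real.log 2 - 2) := by
      field_simp
      ring
    rw [e, hr2]
    nlinarith [mul_pos hL0 hln2]
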